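/- For real $q$ with $|q|<1$ (for a prime $p$ one takes $q=1/p$) put $$\Sigma(q,x)=e^{-x/2}\sum_{m\ge 1}\frac{q^m}{\sqrt{1+q^{2m}e^{-2x}}},\qquad G(q,x)=\frac{1}{\sqrt{e^{-x}+e^{x}}}+\Sigma(q,x)+\Sigma(q,-x),$$ and define moments by $c_q(2k)=(-1)^k\,\partial_x^{2k}G(q,x)|_{x=0}$ and $c_q(j)=0$ for odd $j$. For each fixed $n$ and all $q$ sufficiently close to $0$ let $P_0,P_1,\dots,P_{n+1}$ be the orthonormal polynomials with positive leading coefficients obtained from $1,x,\dots,x^{n+1}$ by orthogonalization with respect to $\langle x^i,x^j\rangle=c_q(i+j)$, let $a_m=\langle xP_m,P_{m+1}\rangle$ be the Jacobi coefficients (with $a_{-1}=0$), let $A$ be the Jacobi matrix, $Ae_m=a_{m-1}e_{m-1}+a_me_{m+1}$, let $N$ be the grading, $Ne_m=me_m$, and let $E_+=\frac14+N+\frac1{2i}[A,N]$. Then $[A,E_+]=2iE_++D$ with $D$ diagonal; let $d_n=d_n(q)$ be its $n$-th diagonal entry, i.e. $-i\,d_n=-2n-\frac12+a_n^2-a_{n-1}^2$.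 Let $\alpha_n=(-4)^{-n}\binom{2n}{n}$ and $t(n)=2\sqrt2\,\alpha_n$. **Theorem.** For every integer $n\ge 0$ the hypergeometric series for $Y={}_2F_1\left(1,n+\frac12;n+1;-1\right)$ converges (as the limit of its partial sums), and for all real $q$ in a neighbourhood of $0$ one has a convergent expansion $-i\,d_n(q)=\sum_{j\ge0}\delta_j q^j$ whose coefficient of $q^3$ is $$\delta_3=-\tfrac1{16}(16n^2+8n+3)\,t(n)^3\,Y^2+\tfrac14(4n^2+11n+3)\,t(n)^3\,Y-\left(4n^4+4n^3+\tfrac{23n^2}{4}+\tfrac{7n}{2}+\tfrac34\right)t(n)^3+\left(32n^4+32n^3+48n^2+20n+\tfrac{27}{8}\right)t(n).$$ -/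

import Mathlib

open Filter Topology Polynomial

noncomputable section

/-- `α_ℓ = (-4)^{-ℓ} binom(2ℓ, ℓ)`, the Taylor coefficients of `1 / √(1 + x²)` in `x²`. -/
def alphaCoeff (l : ℕ) : ℝ := ((-4 : ℝ) ^ l)⁻¹ * (Nat.choose (2 * l) l : ℝ)

/-- `t(n) = 2√2 α_n`. -/
def tCoeff (n : ℕ) : ℝ := 2 * Real.sqrt 2 * alphaCoeff n

/-- `Σ_p(x)` as a function of `q = 1/p`:
`e^{-x/2} ∑_{m ≥ 1} q^m / √(1 + q^{2m} e^{-2x})`, which for `q = 1/p > 0` is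
`∑_{m ≥ 1} 1 / √(p^{2m} e^x + e^{-x})`. The series converges for all real `|q| < 1`. -/
def sigmaSeries (q x : ℝ) : ℝ :=
  Real.exp (-x / 2) *
    ∑' m : ℕ, q ^ (m + 1) / Real.sqrt (1 + q ^ (2 * (m + 1)) * Real.exp (-2 * x))

/-- The generating function of the moments, `1 / √(e^{-x} + e^x) + Σ_p(x) + Σ_p(-x)`, `q = 1/p`. -/
def momentGen (q x : ℝ) : ℝ :=
  1 / Real.sqrt (Real.exp (-x) + Real.exp x) + sigmaSeries q x + sigmaSeries q (-x)

/-- The moments: `c(2k) = (-1)^k (∂_x^{2k} momentGen q)(0)`, and the odd moments vanish. -/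
def moment (q : ℝ) (j : ℕ) : ℝ :=
  if Even j then (-1) ^ (j / 2) * iteratedDeriv j (momentGen q) 0 else 0

/-- The linear functional on polynomials ("integration") with given moments `c`. -/
def momentFunctional (c : ℕ → ℝ) (f : ℝ[X]) : ℝ := f.sum fun j a => a * c j

/-- The monic orthogonal polynomials, obtained from `1, x, x², …` by orthogonalization
with respect to the inner product `⟨f, g⟩ = momentFunctional c (f * g)`. -/
def monicOrthoPoly (c : ℕ → ℝ) (n : ℕ) : ℝ[X] :=
  X ^ n - ∑ k : Fin n,
    C (momentFunctional c (X ^ n * monicOrthoPoly c k.1) /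
        momentFunctional c (monicOrthoPoly c k.1 * monicOrthoPoly c k.1)) *
      monicOrthoPoly c k.1
termination_by n
decreasing_by all_goals exact k.2

/-- The orthonormal polynomials `P_n`, with positive leading coefficient. -/
def orthoPoly (c : ℕ → ℝ) (n : ℕ) : ℝ[X] :=
  C (1 / Real.sqrt (momentFunctional c (monicOrthoPoly c n * monicOrthoPoly c n))) *
    monicOrthoPoly c n

/-- The Jacobi coefficients `a_n = ⟨x P_n, P_{n+1}⟩`. -/
def jacobiCoeff (c : ℕ → ℝ) (n : ℕ) : ℝ :=
  momentFunctional c (X * orthoPoly c n * orthoPoly c (n + 1))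

/-- The Jacobi matrix `A`, acting on finitely supported sequences:
`A e_n = a_{n-1} e_{n-1} + a_n e_{n+1}` (and `A e_0 = a_0 e_1`). -/
def jacobiOp (a : ℕ → ℝ) : Module.End ℂ (ℕ →₀ ℂ) :=
  Finsupp.linearCombination ℂ fun n : ℕ =>
    (if n = 0 then 0 else Finsupp.single (n - 1) (a (n - 1) : ℂ)) +
      Finsupp.single (n + 1) (a n : ℂ)

/-- The integer grading `N e_n = n e_n`. -/
def gradingOp : Module.End ℂ (ℕ →₀ ℂ) :=
  Finsupp.linearCombination ℂ fun n : ℕ => Finsupp.single n (n : ℂ)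

/-- `E₊ = 1/4 + N + (1/2i) [A, N]`. -/
def ePlus (a : ℕ → ℝ) : Module.End ℂ (ℕ →₀ ℂ) :=
  (1 / 4 : ℂ) • (1 : Module.End ℂ (ℕ →₀ ℂ)) + gradingOp +
    (1 / (2 * Complex.I)) • ⁅jacobiOp a, gradingOp⁆

/-- The matrix `D`, determined by `[A, E₊] = 2i E₊ + D`. -/
def diagOp (a : ℕ → ℝ) : Module.End ℂ (ℕ →₀ ℂ) :=
  ⁅jacobiOp a, ePlus a⁆ - (2 * Complex.I) • ePlus a

/-- The diagonal entry `d_n(q)` of `D`, for the Jacobi matrix of the moments at `q`. -/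
def dEntry (n : ℕ) (q : ℝ) : ℂ :=
  diagOp (jacobiCoeff (moment q)) (Finsupp.single n 1) n

/-- `Y` is the value `₂F₁(a, b; c; z)`, as the limit of the partial sums of the hypergeometric
series. (At `z = -1` the series may converge only conditionally.) -/
def IsHypergeometricValue (a b c z Y : ℝ) : Prop :=
  Tendsto (fun K : ℕ => ∑ k ∈ Finset.range K, ordinaryHypergeometricCoefficient a b c k * z ^ k)
    atTop (𝓝 Y)

end

/-! Expanding `1/√(1+u)` in `Σ` gives, for small `q`, `c_q = c_0 + ∑ α_l q^{(2l+1)m} μ_l` over `m ≥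
1`, `l ≥ 0`, where `μ_l` are the moments of unit point masses at `± i(2l+1/2)` (`moment_eq_tsum`).
Modulo `q^4` only `(q+q²+q³) μ_0` and `α_1 q³ μ_1 = -q³ μ_1/2` survive (`moment_isBigO`).

At `q = 0` the monic orthogonal polynomials are the Meixner–Pollaczek polynomials `p_n`, with
explicit norms `h_n`. Their values at `i/2` and `5i/2` are `iⁿ (1/2)_n` and `iⁿ (1/2)_n (4n+1)`, so
`μ_0(p_n²) = h_n t(n)` and `μ_1(p_n²) = h_n t(n)(4n+1)²`. Between polynomials of equal parity `μ_0`
is a rank-one form, and between opposite parities it vanishes. Adding `ε μ_0` is therefore exactly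
solvable: the norm becomes `h_n (1 + ε t(n)/(1 + ε s_n))`, where `s_n` sums `t(k)` over `k < n` with
`k ≡ n` mod 2 (`momentLin_tiltPoly_mul_monic`). The `μ_1` term only enters to first order, giving
the norms for `c_q` modulo `q^4` (`isBigO_orthoNorm`).

Since `a_n²` is a ratio of consecutive norms, `-i d_n` has an explicit cubic jet in `t(n)`, `s_n`
and their neighbours. The hypergeometric value enters through `s_n + s_{n+1} = ∑_{k<n} t(k) = 2 -
t(n) Y`, as `Y` is the normalised tail of `∑ α_k = 1/√2`; together with `s_{n+1} - s_n = -2n t(n)`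
this determines both parity sums. Analyticity in `q` makes the jet coefficient the power series
coefficient. -/

/-! ### The binomial coefficients `α_l` and their sum. -/

theorem alphaCoeff_zero : alphaCoeff 0 = 1 := by simp [alphaCoeff]

theorem succ_mul_alphaCoeff_succ (l : ℕ) :
    ((l : ℝ) + 1) * alphaCoeff (l + 1) = -((l : ℝ) + 1 / 2) * alphaCoeff l := by
  have h := Nat.succ_mul_centralBinom_succ l
  simp only [Nat.centralBinom_eq_two_mul_choose] at h
  have h' : ((l : ℝ) + 1) * ((2 * (l + 1)).choose (l + 1) : ℝ)
      = 2 * (2 * l + 1) * ((2 * l).choose l : ℝ) := by exact_mod_cast h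
  unfold alphaCoeff
  rw [pow_succ, mul_inv]
  linear_combination ((-4 : ℝ) ^ l)⁻¹ * (-4 : ℝ)⁻¹ * h'

theorem alphaCoeff_succ (l : ℕ) :
    alphaCoeff (l + 1) = -((l : ℝ) + 1 / 2) / (l + 1) * alphaCoeff l := by
  have h := succ_mul_alphaCoeff_succ l
  have : (l : ℝ) + 1 ≠ 0 := by positivity
  field_simp
  linear_combination 2 * h

theorem alphaCoeff_one : alphaCoeff 1 = -(1 / 2) := by
  rw [alphaCoeff_succ, alphaCoeff_zero]; norm_num

/-- The absolute value of `alphaCoeff`. -/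
noncomputable def absAlpha (l : ℕ) : ℝ := (-1) ^ l * alphaCoeff l

theorem alphaCoeff_eq (l : ℕ) : alphaCoeff l = (-1) ^ l * absAlpha l := by
  unfold absAlpha
  rw [← mul_assoc, ← mul_pow]; simp

theorem absAlpha_succ (l : ℕ) :
    absAlpha (l + 1) = ((l : ℝ) + 1 / 2) / (l + 1) * absAlpha l := by
  unfold absAlpha
  rw [alphaCoeff_succ]; ring

theorem absAlpha_pos (l : ℕ) : 0 < absAlpha l := by
  induction l with
  | zero => simp [absAlpha, alphaCoeff_zero]
  | succ l ih => rw [absAlpha_succ]; positivity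

theorem alphaCoeff_ne_zero (l : ℕ) : alphaCoeff l ≠ 0 := by
  rw [alphaCoeff_eq]
  exact mul_ne_zero (by simp) (absAlpha_pos l).ne'

theorem antitone_absAlpha : Antitone absAlpha := by
  refine antitone_nat_of_succ_le fun l => ?_
  rw [absAlpha_succ]
  refine mul_le_of_le_one_left (absAlpha_pos l).le ?_
  rw [div_le_one (by positivity)]; linarith

theorem absAlpha_le_one (l : ℕ) : absAlpha l ≤ 1 := by
  have h := antitone_absAlpha (Nat.zero_le l)
  simpa [absAlpha, alphaCoeff_zero] using h

theorem abs_alphaCoeff (l : ℕ) : |alphaCoeff l| = absAlpha l := by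
  rw [alphaCoeff_eq, abs_mul, abs_pow, abs_neg, abs_one, one_pow, one_mul,
    abs_of_pos (absAlpha_pos l)]

/-- A form of the Wallis bound that is stable under induction; it forces `absAlpha` to tend to zero.
-/
theorem sq_absAlpha_mul_le (l : ℕ) : absAlpha l ^ 2 * (2 * l + 1) ≤ 1 := by
  induction l with
  | zero => simp [absAlpha, alphaCoeff_zero]
  | succ l ih =>
    refine le_trans ?_ ih
    rw [absAlpha_succ]
    have h : (((l : ℝ) + 1 / 2) / (l + 1)) ^ 2 * (2 * (l + 1) + 1) ≤ 2 * l + 1 := by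
      rw [div_pow, div_mul_eq_mul_div, div_le_iff₀ (by positivity)]
      nlinarith [(Nat.cast_nonneg l : (0 : ℝ) ≤ l)]
    push_cast
    nlinarith [mul_le_mul_of_nonneg_left h (sq_nonneg (absAlpha l))]

theorem tendsto_absAlpha : Tendsto absAlpha atTop (𝓝 0) := by
  have h2 : Tendsto (fun l => absAlpha l ^ 2) atTop (𝓝 0) := by
    refine squeeze_zero (fun l => sq_nonneg _) (fun l => ?_)
      tendsto_one_div_add_atTop_nhds_zero_nat
    have := sq_absAlpha_mul_le l
    rw [le_div_iff₀ (by positivity)]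
    nlinarith [sq_nonneg (absAlpha l), (Nat.cast_nonneg l : (0 : ℝ) ≤ l),
      mul_nonneg (sq_nonneg (absAlpha l)) (Nat.cast_nonneg l : (0 : ℝ) ≤ l)]
  have h3 := h2.sqrt
  simpa [Real.sqrt_sq (absAlpha_pos _).le] using h3

theorem ringChoose_neg_half (l : ℕ) : Ring.choose (-(1 / 2) : ℝ) l = alphaCoeff l := by
  induction l with
  | zero => simp [alphaCoeff_zero]
  | succ l ih =>
    rw [alphaCoeff_succ, ← ih, Ring.choose_eq_smul, Ring.choose_eq_smul,
      descPochhammer_succ_right, Polynomial.smeval_mul, Nat.factorial_succ]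
    simp [Polynomial.smeval_sub, Polynomial.smeval_natCast]
    field_simp
    ring

theorem hasSum_alphaCoeff {u : ℝ} (hu : |u| < 1) :
    HasSum (fun l => alphaCoeff l * u ^ l) (1 / Real.sqrt (1 + u)) := by
  have h := (Real.one_add_rpow_hasFPowerSeriesOnBall_zero (a := -(1 / 2))).hasSum
    (y := u) (by simpa [← ENNReal.ofReal_one, enorm_eq_nnnorm, ← NNReal.coe_lt_coe] using hu)
  have hpos : 0 ≤ 1 + u := by linarith [(abs_lt.1 hu).1]
  have hc (l : ℕ) : (binomialSeries ℝ (-(1 / 2) : ℝ)).coeff l = alphaCoeff l := by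
    rw [binomialSeries, FormalMultilinearSeries.coeff_ofScalars, ringChoose_neg_half]
  rw [one_div (Real.sqrt _)]
  simpa [hc, Real.rpow_neg hpos, Real.sqrt_eq_rpow, mul_comm, -one_div] using h

/-- The point `u = 1` lies on the circle of convergence: the alternating series test gives
convergence, and Abel's theorem identifies the limit. -/
theorem tendsto_sum_alphaCoeff :
    Tendsto (fun K => ∑ k ∈ Finset.range K, alphaCoeff k) atTop (𝓝 (1 / Real.sqrt 2)) := by
  obtain ⟨L, hL⟩ := antitone_absAlpha.tendsto_alternating_series_of_tendsto_zero tendsto_absAlpha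
  simp only [← alphaCoeff_eq] at hL
  have h1 := Real.tendsto_tsum_powerSeries_nhdsWithin_lt hL
  have h2 : Tendsto (fun x : ℝ => 1 / Real.sqrt (1 + x)) (𝓝[<] 1) (𝓝 (1 / Real.sqrt 2)) := by
    have : ContinuousAt (fun x : ℝ => 1 / Real.sqrt (1 + x)) 1 := by
      refine ContinuousAt.div (by fun_prop) (by fun_prop) (by positivity)
    have := this.tendsto
    rw [show (1 : ℝ) + 1 = 2 by norm_num] at this
    exact this.mono_left nhdsWithin_le_nhds
  have h3 : L = 1 / Real.sqrt 2 := by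
    refine tendsto_nhds_unique (h1.congr' ?_) h2
    filter_upwards [Ioo_mem_nhdsLT (show (0 : ℝ) < 1 by norm_num)] with x hx
    exact (hasSum_alphaCoeff (by rw [abs_of_pos hx.1]; exact hx.2)).tsum_eq
  rwa [h3] at hL

/-! ### Exponential expansion of `Σ` and termwise differentiation. -/

theorem iteratedDeriv_eq_of_hasDerivAt {s : Set ℝ} (hs : IsOpen s) {f : ℝ → ℝ} {g : ℕ → ℝ → ℝ}
    (h0 : ∀ x ∈ s, f x = g 0 x) (h : ∀ k, ∀ x ∈ s, HasDerivAt (g k) (g (k + 1) x) x) (k : ℕ) :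
    ∀ x ∈ s, iteratedDeriv k f x = g k x := by
  induction k with
  | zero => simpa using h0
  | succ k ih =>
    intro x hx
    rw [iteratedDeriv_succ]
    have : iteratedDeriv k f =ᶠ[𝓝 x] g k := by
      filter_upwards [hs.mem_nhds hx] with y hy using ih y hy
    rw [this.deriv_eq]
    exact (h k x hx).deriv

/-- The exponents `2 l + 1 / 2` in the exponential expansion of the moment generating function. -/
noncomputable def expRate (l : ℕ) : ℝ := 2 * l + 1 / 2

theorem expRate_pos (l : ℕ) : 0 < expRate l := by unfold expRate; positivity

/-- The exponent of `q` in the double expansion of `sigmaSeries`. -/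
def qExponent (i : ℕ × ℕ) : ℕ := (2 * i.2 + 1) * (i.1 + 1)

theorem summable_expRate_pow_mul (k : ℕ) :
    Summable fun i : ℕ × ℕ =>
      expRate i.2 ^ k * Real.exp (expRate i.2 / 8) * (1 / 2 : ℝ) ^ qExponent i := by
  have h1 : Summable fun m : ℕ => (1 / 2 : ℝ) ^ m := summable_geometric_two
  -- Once `expRate l ^ k` is absorbed into a second factor `e^{r/8}`, the growth `e^{r/4} = e^{1/8}
  -- e^{l/2}` competes with the decay `4^{-l}` of the power of `1/2`.
  have hr : Real.exp (1 / 2) / 4 < 1 := by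
    have : Real.exp (1 / 2) < Real.exp 1 := Real.exp_lt_exp.2 (by norm_num)
    have := Real.exp_one_lt_d9
    linarith
  have h2 : Summable fun l : ℕ => (Real.exp (1 / 2) / 4) ^ l :=
    summable_geometric_of_lt_one (by positivity) hr
  have h3 := (h1.mul_of_nonneg h2 (fun _ => by positivity) (fun _ => by positivity)).mul_left
    ((k.factorial : ℝ) * 8 ^ k * Real.exp (1 / 8))
  refine Summable.of_nonneg_of_le (fun i => ?_) (fun i => ?_) h3
  · have := expRate_pos i.2
    positivity
  · have hp := expRate_pos i.2
    have e1 : expRate i.2 ^ k ≤ (k.factorial : ℝ) * 8 ^ k * Real.exp (expRate i.2 / 8) := by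
      have := Real.pow_div_factorial_le_exp (expRate i.2 / 8) (by positivity) k
      rw [div_pow, div_div, div_le_iff₀ (by positivity)] at this
      linarith
    have e2 : (1 / 2 : ℝ) ^ qExponent i ≤ (1 / 2) ^ i.1 * (1 / 4) ^ i.2 := by
      rw [show (1 / 4 : ℝ) = (1 / 2) ^ 2 by norm_num, ← pow_mul, ← pow_add]
      refine pow_le_pow_of_le_one (by norm_num) (by norm_num) ?_
      unfold qExponent; nlinarith
    calc _ ≤ ((k.factorial : ℝ) * 8 ^ k * Real.exp (expRate i.2 / 8)) *
          Real.exp (expRate i.2 / 8) * ((1 / 2) ^ i.1 * (1 / 4) ^ i.2) := by gcongr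
      _ = _ := by
        have : Real.exp (expRate i.2 / 8) * Real.exp (expRate i.2 / 8)
            = Real.exp (1 / 8) * Real.exp (1 / 2) ^ i.2 := by
          rw [← Real.exp_nat_mul, ← Real.exp_add, ← Real.exp_add]
          unfold expRate; ring_nf
        rw [div_eq_mul_one_div (Real.exp (1 / 2)), mul_pow]
        generalize (1 / 2 : ℝ) ^ i.1 = a, (1 / 4 : ℝ) ^ i.2 = b
        linear_combination ((k.factorial : ℝ) * 8 ^ k) * (a * b) * this

/-- The coefficients of the exponential expansion of `sigmaSeries`. -/
noncomputable def expCoeff (q : ℝ) (i : ℕ × ℕ) : ℝ := alphaCoeff i.2 * q ^ qExponent i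

theorem abs_expCoeff_le {q : ℝ} (hq : |q| < 1 / 2) (i : ℕ × ℕ) :
    |expCoeff q i| ≤ (1 / 2 : ℝ) ^ qExponent i := by
  unfold expCoeff
  rw [abs_mul, abs_pow, abs_alphaCoeff]
  calc absAlpha i.2 * |q| ^ qExponent i ≤ 1 * (1 / 2) ^ qExponent i := by
        gcongr
        exact absAlpha_le_one _
    _ = _ := one_mul _

theorem abs_expCoeff_mul_exp_le {q x : ℝ} (hq : |q| < 1 / 2) (hx : |x| < 1 / 8) (k : ℕ)
    (i : ℕ × ℕ) : |expCoeff q i * expRate i.2 ^ k * Real.exp (expRate i.2 * x)| ≤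
      expRate i.2 ^ k * Real.exp (expRate i.2 / 8) * (1 / 2 : ℝ) ^ qExponent i := by
  have hp := expRate_pos i.2
  rw [abs_mul, abs_mul, abs_of_pos (Real.exp_pos _), abs_of_pos (pow_pos hp k)]
  have h1 : expRate i.2 * x ≤ expRate i.2 / 8 := by nlinarith [(abs_lt.1 hx).2]
  calc _ ≤ (1 / 2 : ℝ) ^ qExponent i * expRate i.2 ^ k * Real.exp (expRate i.2 / 8) := by
        gcongr
        exact abs_expCoeff_le hq i
    _ = _ := by ring

theorem summable_expCoeff_mul_exp {q x : ℝ} (hq : |q| < 1 / 2) (hx : |x| < 1 / 8) (k : ℕ) :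
    Summable fun i : ℕ × ℕ => expCoeff q i * expRate i.2 ^ k * Real.exp (expRate i.2 * x) :=
  Summable.of_norm_bounded (summable_expRate_pow_mul k)
    fun i => abs_expCoeff_mul_exp_le hq hx k i

/-- The termwise `k`-th derivative of the exponential expansion. -/
noncomputable def expSeries (q : ℝ) (k : ℕ) (x : ℝ) : ℝ :=
  ∑' i : ℕ × ℕ, expCoeff q i * expRate i.2 ^ k * Real.exp (expRate i.2 * x)

theorem sigmaSeries_eq {q x : ℝ} (hq : |q| < 1 / 2) (hx : |x| < 1 / 8) :
    sigmaSeries q x = expSeries q 0 (-x) := by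
  have hs := (summable_expCoeff_mul_exp hq (x := -x) (by rwa [abs_neg]) 0).hasSum
  have hu (m : ℕ) : |q ^ (2 * (m + 1)) * Real.exp (-2 * x)| < 1 := by
    have h1 : Real.exp (-2 * x) < 4 := by
      have : Real.exp (-2 * x) < Real.exp 1 :=
        Real.exp_lt_exp.2 (by linarith [(abs_lt.1 hx).1])
      linarith [Real.exp_one_lt_d9]
    have h2 : |q| ^ (2 * (m + 1)) ≤ 1 / 4 := by
      calc |q| ^ (2 * (m + 1)) ≤ (1 / 2) ^ (2 * (m + 1)) := by gcongr
        _ ≤ (1 / 2) ^ 2 := pow_le_pow_of_le_one (by norm_num) (by norm_num) (by omega)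
        _ = 1 / 4 := by norm_num
    rw [abs_mul, abs_pow, abs_of_pos (Real.exp_pos _)]
    nlinarith [Real.exp_pos (-2 * x)]
  have hf := hs.prod_fiberwise (g := fun m => Real.exp (-x / 2) *
      (q ^ (m + 1) / Real.sqrt (1 + q ^ (2 * (m + 1)) * Real.exp (-2 * x)))) fun m => by
    have := ((hasSum_alphaCoeff (hu m)).mul_left (q ^ (m + 1))).mul_left (Real.exp (-x / 2))
    convert! this using 1
    · funext l
      have h1 : Real.exp (expRate l * -x) = Real.exp (-x / 2) * Real.exp (-2 * x) ^ l := by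
        rw [← Real.exp_nat_mul, ← Real.exp_add]
        unfold expRate; ring_nf
      simp only [expCoeff, qExponent, h1]
      ring
    · ring
  rw [sigmaSeries, ← tsum_mul_left]
  exact hf.tsum_eq

theorem hasDerivAt_expSeries {q x : ℝ} (hq : |q| < 1 / 2) (hx : |x| < 1 / 8) (k : ℕ) :
    HasDerivAt (expSeries q k) (expSeries q (k + 1) x) x := by
  have hball (y : ℝ) : y ∈ Metric.ball (0 : ℝ) (1 / 8) ↔ |y| < 1 / 8 := by simp
  refine hasDerivAt_tsum_of_isPreconnected (t := Metric.ball 0 (1 / 8)) (y₀ := 0)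
    (g := fun i y => expCoeff q i * expRate i.2 ^ k * Real.exp (expRate i.2 * y))
    (g' := fun i y => expCoeff q i * expRate i.2 ^ (k + 1) * Real.exp (expRate i.2 * y))
    (summable_expRate_pow_mul (k + 1)) Metric.isOpen_ball
    (convex_ball _ _).isPreconnected (fun i y _ => ?_) (fun i y hy => ?_) (by simp)
    (summable_expCoeff_mul_exp hq (by simp) k) ((hball x).2 hx)
  · have h := ((hasDerivAt_id y).const_mul (expRate i.2)).exp.const_mul
      (expCoeff q i * expRate i.2 ^ k)
    refine h.congr_deriv ?_
    simp only [id]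
    ring
  · exact abs_expCoeff_mul_exp_le hq ((hball y).1 hy) (k + 1) i

/-! ### Derivatives of `1/√(2 cosh x)` through `tanh x`. -/

/-- The differential operator induced on polynomials in `tanh x` by differentiating
their products with `1 / √(2 cosh x)`. -/
noncomputable def tanhOp : Module.End ℝ ℝ[X] :=
  LinearMap.mulLeft ℝ (1 - X ^ 2) ∘ₗ derivative - LinearMap.mulLeft ℝ (C (1 / 2) * X)

theorem tanhOp_apply (Q : ℝ[X]) :
    tanhOp Q = (1 - X ^ 2) * derivative Q - C (1 / 2) * X * Q := by
  simp [tanhOp, mul_assoc]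

/-- The iterated derivatives of `1 / √(e^{-x} + e^x)`. -/
noncomputable def baseDeriv (k : ℕ) (x : ℝ) : ℝ :=
  ((tanhOp ^ k) 1).eval ((Real.exp x - Real.exp (-x)) / (Real.exp (-x) + Real.exp x)) *
    (1 / Real.sqrt (Real.exp (-x) + Real.exp x))

/-- With `w = e^x + e^{-x}` and `T = tanh x`, one has `T' = 1 - T²` and `w'/w = T`, which yields
`tanhOp`. -/
theorem hasDerivAt_baseDeriv (k : ℕ) (x : ℝ) :
    HasDerivAt (baseDeriv k) (baseDeriv (k + 1) x) x := by
  have hpos : 0 < Real.exp (-x) + Real.exp x := by positivity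
  have he : HasDerivAt (fun x : ℝ => Real.exp (-x)) (-Real.exp (-x)) x := by
    simpa using (hasDerivAt_neg x).exp
  have hw : HasDerivAt (fun x : ℝ => Real.exp (-x) + Real.exp x)
      (-Real.exp (-x) + Real.exp x) x := he.add (Real.hasDerivAt_exp x)
  have hn : HasDerivAt (fun x : ℝ => Real.exp x - Real.exp (-x))
      (Real.exp x - -Real.exp (-x)) x := (Real.hasDerivAt_exp x).sub he
  have hT := hn.div hw hpos.ne'
  have hQ := (((tanhOp ^ k) 1).hasDerivAt
    ((Real.exp x - Real.exp (-x)) / (Real.exp (-x) + Real.exp x))).comp x hT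
  have hs := (hw.sqrt hpos.ne').inv (Real.sqrt_pos.2 hpos).ne'
  have h := hQ.mul hs
  unfold baseDeriv
  simp only [one_div]
  convert! h using 1
  rw [pow_succ', Module.End.mul_apply, tanhOp_apply]
  have h2 := Real.sq_sqrt hpos.le
  have h3 := (Real.sqrt_pos.2 hpos).ne'
  simp only [eval_sub, eval_mul, eval_one, eval_pow, eval_X, eval_C, Pi.inv_apply, Pi.div_apply,
    Function.comp]
  set w := Real.sqrt (Real.exp (-x) + Real.exp x)
  rw [h2]
  field_simp
  ring

/-- The operator on `ℝ[X]` whose powers give the moments at `q = 0`. -/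
noncomputable def tanOp : Module.End ℝ ℝ[X] :=
  LinearMap.mulLeft ℝ (1 + X ^ 2) ∘ₗ derivative + LinearMap.mulLeft ℝ (C (1 / 2) * X)

theorem tanOp_apply (Q : ℝ[X]) :
    tanOp Q = (1 + X ^ 2) * derivative Q + C (1 / 2) * X * Q := by
  simp [tanOp, mul_assoc]

/-- Substituting `iX` for `X` turns `1 - X²` into `1 + X²`. The factors `i^k` absorb the signs
`(-1)^k` in the definition of the moments. -/
theorem tanhOp_pow_comp (k : ℕ) :
    C (Complex.I ^ k) * (((tanhOp ^ k) 1).map (algebraMap ℝ ℂ)).comp (C Complex.I * X) =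
      ((tanOp ^ k) 1).map (algebraMap ℝ ℂ) := by
  induction k with
  | zero => simp
  | succ k ih =>
    have hd := congrArg derivative ih
    rw [derivative_mul, derivative_C, zero_mul, zero_add, derivative_comp, derivative_map] at hd
    rw [pow_succ' tanhOp, pow_succ' tanOp, Module.End.mul_apply, Module.End.mul_apply,
      tanhOp_apply, tanOp_apply]
    simp only [Polynomial.map_add, Polynomial.map_sub, Polynomial.map_mul, Polynomial.map_one,
      Polynomial.map_pow, map_X, map_C, sub_comp, mul_comp, one_comp, pow_comp, X_comp,
      C_comp, derivative_map] at hd ⊢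
    rw [← ih, ← derivative_map, ← hd]
    have hI : (C Complex.I : ℂ[X]) ^ 2 = -1 := by rw [← C_pow]; simp
    simp only [derivative_mul, derivative_C, derivative_X, C_pow, derivative_map]
    set F := (map (algebraMap ℝ ℂ) ((tanhOp ^ k) 1)).comp (C Complex.I * X)
    set F' := (map (algebraMap ℝ ℂ) (derivative ((tanhOp ^ k) 1))).comp (C Complex.I * X)
    linear_combination (-(C Complex.I ^ k * X * C ((algebraMap ℝ ℂ) (1 / 2)) * F)
      - C Complex.I * C Complex.I ^ k * X ^ 2 * F') * hI

theorem eval_tanhOp_pow (k : ℕ) :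
    Complex.I ^ k * (((tanhOp ^ k) 1).eval 0 : ℝ) = (((tanOp ^ k) 1).eval 0 : ℝ) := by
  have h := congrArg (eval 0) (tanhOp_pow_comp k)
  rw [eval_mul, eval_C, eval_comp, eval_mul, eval_X, mul_zero, eval_zero_map, eval_zero_map] at h
  exact h

theorem iteratedDeriv_momentGen {q : ℝ} (hq : |q| < 1 / 2) (k : ℕ) :
    iteratedDeriv k (momentGen q) 0 = baseDeriv k 0 + (1 + (-1) ^ k) * expSeries q k 0 := by
  have hball (y : ℝ) : y ∈ Metric.ball (0 : ℝ) (1 / 8) ↔ |y| < 1 / 8 := by simp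
  have h := iteratedDeriv_eq_of_hasDerivAt (s := Metric.ball 0 (1 / 8)) Metric.isOpen_ball
    (f := momentGen q)
    (g := fun k x => baseDeriv k x + (-1) ^ k * expSeries q k (-x) + expSeries q k x)
    (fun x hx => ?_) (fun k x hx => ?_) k 0 (by simp)
  · rw [h]; simp; ring
  · rw [hball] at hx
    rw [momentGen, sigmaSeries_eq hq hx, sigmaSeries_eq hq (by rwa [abs_neg])]
    simp [baseDeriv]
  · rw [hball] at hx
    have h1 : HasDerivAt (fun x => expSeries q k (-x)) (expSeries q (k + 1) (-x) * -1) x :=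
      (hasDerivAt_expSeries hq (x := -x) (by rwa [abs_neg]) k).comp x (hasDerivAt_neg x)
    refine (((hasDerivAt_baseDeriv k x).add (h1.const_mul ((-1) ^ k))).add
      (hasDerivAt_expSeries hq hx k)).congr_deriv ?_
    ring

/-! ### The moments as a base functional plus point masses. -/

/-- The moments at `q = 0`. -/
noncomputable def baseMoment (j : ℕ) : ℝ := 1 / Real.sqrt 2 * ((tanOp ^ j) 1).eval 0

/-- The moments of the sum of the point masses at `± i (2 l + 1 / 2)`. -/
noncomputable def pointMoment (l j : ℕ) : ℝ := 2 * ((Complex.I * (expRate l : ℂ)) ^ j).re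

theorem baseDeriv_zero (k : ℕ) : baseDeriv k 0 = 1 / Real.sqrt 2 * ((tanhOp ^ k) 1).eval 0 := by
  rw [baseDeriv]
  norm_num [mul_comm]

theorem moment_eq_tsum {q : ℝ} (hq : |q| < 1 / 2) (j : ℕ) :
    moment q j = baseMoment j + ∑' i : ℕ × ℕ, expCoeff q i * pointMoment i.2 j := by
  have he := eval_tanhOp_pow j
  unfold moment
  rcases Nat.even_or_odd j with hj | hj
  · obtain ⟨k, rfl⟩ := hj
    have hI : Complex.I ^ (k + k) = (((-1 : ℝ) ^ k : ℝ) : ℂ) := by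
      rw [← two_mul, pow_mul, Complex.I_sq]; push_cast; rfl
    have hkk : (k + k) / 2 = k := by omega
    rw [if_pos ⟨k, rfl⟩, iteratedDeriv_momentGen hq, hkk, baseDeriv_zero]
    rw [hI, ← Complex.ofReal_mul, Complex.ofReal_inj] at he
    rw [baseMoment, ← he, mul_add, expSeries, ← mul_assoc _ (1 + _ : ℝ), ← tsum_mul_left]
    congr 1
    · ring
    · refine tsum_congr fun i => ?_
      rw [pointMoment, mul_pow, hI, ← Complex.ofReal_pow, ← Complex.ofReal_mul,
        Complex.ofReal_re, Even.neg_one_pow ⟨k, rfl⟩]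
      simp
      ring
  · obtain ⟨k, rfl⟩ := hj
    obtain ⟨r, hI⟩ : ∃ r : ℝ, Complex.I ^ (2 * k + 1) = (r : ℂ) * Complex.I :=
      ⟨(-1) ^ k, by rw [pow_succ, pow_mul, Complex.I_sq]; push_cast; rfl⟩
    rw [if_neg (by simp)]
    -- For odd exponents `i^j` is purely imaginary while both evaluations are real, so both sides
    -- vanish.
    have h0 : ((tanOp ^ (2 * k + 1)) 1).eval 0 = 0 := by
      have := congrArg Complex.re he
      rw [hI] at this
      simpa using this.symm
    have h1 (l : ℕ) : pointMoment l (2 * k + 1) = 0 := by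
      rw [pointMoment, mul_pow, hI, ← Complex.ofReal_pow, mul_right_comm, ← Complex.ofReal_mul]
      simp [-Complex.ofReal_mul, -Complex.ofReal_pow]
    simp [baseMoment, h0, h1]

/-! ### Analyticity of the moments in `q` and their expansion modulo `q^4`. -/

section QSeries

variable {ι : Type*} {b : ι → ℝ} {N : ι → ℕ}

/-- The complexified series is a locally uniform limit of holomorphic functions on the disc of
radius `1/2`; its real part is then restricted to the real line. -/
theorem analyticAt_tsum_mul_pow (hb : Summable fun i => |b i| * (1 / 2 : ℝ) ^ N i) :
    AnalyticAt ℝ (fun q : ℝ => ∑' i, b i * q ^ N i) 0 := by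
  have hd : DifferentiableOn ℂ (fun z : ℂ => ∑' i, (b i : ℂ) * z ^ N i)
      (Metric.ball 0 (1 / 2)) := by
    refine Complex.differentiableOn_tsum_of_summable_norm hb (fun i => by fun_prop) Metric.isOpen_ball
      fun i w hw => ?_
    rw [norm_mul, norm_pow, Complex.norm_real, Real.norm_eq_abs]
    have : ‖w‖ ≤ 1 / 2 := (mem_ball_zero_iff.1 hw).le
    gcongr
  have ha := (hd.analyticAt (Metric.ball_mem_nhds 0 (by norm_num)))
  have hr := AnalyticAt.re_ofReal (x := 0) (by simpa using ha)
  convert hr using 2 with q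
  rw [← Complex.ofReal_re (∑' i, b i * q ^ N i)]
  push_cast
  rfl

/-- Outside `s`, `|q|^N ≤ |q|^n (1/2)^{N-n}`, so the tail is at most `2^n |q|^n` times the
convergent majorant. -/
theorem isBigO_tsum_mul_pow_sub_sum (hb : Summable fun i => |b i| * (1 / 2 : ℝ) ^ N i)
    (s : Finset ι) {n : ℕ} (hs : ∀ i ∉ s, n ≤ N i) :
    (fun q : ℝ => ∑' i, b i * q ^ N i - ∑ i ∈ s, b i * q ^ N i) =O[𝓝 0] fun q => q ^ n := by
  refine Asymptotics.IsBigO.of_bound (2 ^ n * ∑' i, |b i| * (1 / 2 : ℝ) ^ N i) ?_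
  filter_upwards [Metric.ball_mem_nhds (0 : ℝ) (show (0 : ℝ) < 1 / 2 by norm_num)] with q hq
  have hq' : |q| ≤ 1 / 2 := (mem_ball_zero_iff.1 hq).le
  have hsum : Summable fun i => b i * q ^ N i := by
    refine Summable.of_norm_bounded hb fun i => ?_
    rw [norm_mul, norm_pow, Real.norm_eq_abs, Real.norm_eq_abs]
    gcongr
  rw [← hsum.sum_add_tsum_compl (s := s), add_sub_cancel_left, ← tsum_mul_left, ← tsum_mul_right]
  have hb2 : Summable fun i => 2 ^ n * (|b i| * (1 / 2 : ℝ) ^ N i) * ‖q ^ n‖ :=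
    (hb.mul_left _).mul_right _
  calc _ ≤ ∑' i : ↑((s : Set ι)ᶜ), 2 ^ n * (|b i| * (1 / 2 : ℝ) ^ N i) * ‖q ^ n‖ := by
        refine tsum_of_norm_bounded (hb2.subtype _).hasSum fun i => ?_
        have hi : n ≤ N i := hs _ (fun h => i.2 h)
        obtain ⟨m, hm⟩ := Nat.exists_eq_add_of_le hi
        have h2 : (2 : ℝ) ^ n * (1 / 2) ^ n = 1 := by rw [← mul_pow]; norm_num
        simp only [Function.comp]
        rw [norm_mul, norm_pow, norm_pow, Real.norm_eq_abs, Real.norm_eq_abs, hm, pow_add, pow_add]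
        calc |b i| * (|q| ^ n * |q| ^ m) ≤ |b i| * (|q| ^ n * (1 / 2) ^ m) := by gcongr
          _ = _ := by linear_combination (- |b i| * |q| ^ n * (1 / 2) ^ m) * h2
    _ ≤ _ := hb2.tsum_subtype_le _ _ (fun i => by positivity)

end QSeries

theorem summable_pointMoment (j : ℕ) :
    Summable fun i : ℕ × ℕ =>
      |alphaCoeff i.2 * pointMoment i.2 j| * (1 / 2 : ℝ) ^ qExponent i := by
  refine Summable.of_nonneg_of_le (fun i => by positivity) (fun i => ?_)
    ((summable_expRate_pow_mul j).mul_left 2)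
  have hp := expRate_pos i.2
  have h1 : |pointMoment i.2 j| ≤ 2 * expRate i.2 ^ j := by
    rw [pointMoment, abs_mul, abs_two]
    gcongr
    refine (Complex.abs_re_le_norm _).trans ?_
    simp [abs_of_pos hp]
  have h2 : 1 ≤ Real.exp (expRate i.2 / 8) := Real.one_le_exp (by positivity)
  rw [abs_mul, abs_alphaCoeff]
  calc absAlpha i.2 * |pointMoment i.2 j| * (1 / 2 : ℝ) ^ qExponent i
      ≤ 1 * (2 * expRate i.2 ^ j) * (1 / 2 : ℝ) ^ qExponent i := by
        gcongr
        exact absAlpha_le_one _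
    _ ≤ 1 * (2 * expRate i.2 ^ j) * (1 / 2 : ℝ) ^ qExponent i * Real.exp (expRate i.2 / 8) :=
        le_mul_of_one_le_right (by positivity) h2
    _ = _ := by ring

theorem moment_eventuallyEq (j : ℕ) :
    (fun q => moment q j) =ᶠ[𝓝 0] fun q => baseMoment j +
      ∑' i : ℕ × ℕ, alphaCoeff i.2 * pointMoment i.2 j * q ^ qExponent i := by
  filter_upwards [Metric.ball_mem_nhds (0 : ℝ) (show (0 : ℝ) < 1 / 2 by norm_num)] with q hq
  rw [moment_eq_tsum (by simpa using hq)]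
  congr 1
  refine tsum_congr fun i => ?_
  unfold expCoeff; ring

theorem analyticAt_moment (j : ℕ) : AnalyticAt ℝ (fun q => moment q j) 0 :=
  (analyticAt_const.add (analyticAt_tsum_mul_pow (summable_pointMoment j))).congr
    (moment_eventuallyEq j).symm

theorem moment_zero (j : ℕ) : moment 0 j = baseMoment j := by
  rw [moment_eq_tsum (by simp)]
  simp [expCoeff, qExponent]

theorem moment_isBigO (j : ℕ) :
    (fun q : ℝ => moment q j - (baseMoment j + (q + q ^ 2 + q ^ 3) * pointMoment 0 j) -
      alphaCoeff 1 * q ^ 3 * pointMoment 1 j) =O[𝓝 0] fun q => q ^ 4 := by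
  have h := isBigO_tsum_mul_pow_sub_sum (summable_pointMoment j)
    -- These are the pairs `(m, l)` with `(2l+1)(m+1) ≤ 3`: `l = 0` gives `q, q², q³`, and `(0, 1)`
    -- gives a second `q³`.
    ({(0, 0), (1, 0), (2, 0), (0, 1)} : Finset (ℕ × ℕ)) (n := 4) (by
      rintro ⟨m, l⟩ hi
      simp only [Finset.mem_insert, Finset.mem_singleton, Prod.mk.injEq, not_or] at hi
      unfold qExponent
      rcases l with _ | _ | l
      · simp at hi ⊢; omega
      · simp at hi ⊢; omega
      · simp only; nlinarith [Nat.zero_le l, Nat.zero_le m, Nat.zero_le (l * m)])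
  refine h.congr' ?_ EventuallyEq.rfl
  filter_upwards [moment_eventuallyEq j] with q hq
  rw [hq]
  simp [qExponent, alphaCoeff_zero]
  ring

/-! ### Orthogonal polynomials of a general moment functional. -/

/-- `momentFunctional` as a linear map. -/
noncomputable def momentLin (c : ℕ → ℝ) : ℝ[X] →ₗ[ℝ] ℝ :=
  Polynomial.lsum fun j => c j • LinearMap.id

theorem momentLin_apply (c : ℕ → ℝ) (f : ℝ[X]) : momentLin c f = momentFunctional c f := by
  simp [momentLin, momentFunctional, Polynomial.lsum_apply, mul_comm]

theorem momentLin_X_pow (c : ℕ → ℝ) (j : ℕ) : momentLin c (X ^ j) = c j := by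
  rw [momentLin_apply, momentFunctional, X_pow_eq_monomial, sum_monomial_index _ _ (by simp)]
  simp

theorem momentLin_C_mul (c : ℕ → ℝ) (a : ℝ) (f : ℝ[X]) :
    momentLin c (C a * f) = a * momentLin c f := by
  rw [← smul_eq_C_mul, map_smul, smul_eq_mul]

theorem momentLin_eq_sum_range (c : ℕ → ℝ) {f : ℝ[X]} {N : ℕ} (hf : f.natDegree ≤ N) :
    momentLin c f = ∑ j ∈ Finset.range (N + 1), f.coeff j * c j := by
  rw [momentLin_apply, momentFunctional]
  exact sum_over_range' _ (by simp) _ (by omega)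

/-- A sequence of monic polynomials with one polynomial in each degree. -/
def IsMonicSeq (r : ℕ → ℝ[X]) : Prop := ∀ k, (r k).Monic ∧ (r k).natDegree = k

theorem IsMonicSeq.degree {r : ℕ → ℝ[X]} (hr : IsMonicSeq r) (k : ℕ) : (r k).degree = k := by
  rw [degree_eq_natDegree (hr k).1.ne_zero, (hr k).2]

theorem IsMonicSeq.apply_mul_eq_zero {r : ℕ → ℝ[X]} (hr : IsMonicSeq r) (L : ℝ[X] →ₗ[ℝ] ℝ)
    {g : ℝ[X]} {m : ℕ} (h : ∀ k < m, L (g * r k) = 0) :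
    ∀ f : ℝ[X], f.degree < m → L (g * f) = 0 := by
  induction m with
  | zero =>
    intro f hf
    have : f = 0 := by simpa [Nat.WithBot.lt_zero_iff] using hf
    simp [this]
  | succ m ih =>
    intro f hf
    have hd : (f - C (f.coeff m) * r m).degree < m := by
      rw [degree_lt_iff_coeff_zero]
      intro j hj
      rcases hj.eq_or_lt with rfl | hj
      · have : (r m).coeff m = 1 := by
          have := (hr m).1.coeff_natDegree
          rwa [(hr m).2] at this
        simp [this]
      · have h1 : f.coeff j = 0 := (degree_lt_iff_coeff_zero f (m + 1)).1 hf j hj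
        have h2 : (r m).coeff j = 0 := coeff_eq_zero_of_natDegree_lt (by rw [(hr m).2]; exact hj)
        simp [h1, h2]
    have h1 := ih (fun k hk => h k (by omega)) _ hd
    have h2 : L (g * (C (f.coeff m) * r m)) = 0 := by
      rw [mul_left_comm, ← smul_eq_C_mul, map_smul, h m (by omega), smul_zero]
    rw [mul_sub, map_sub, h2, sub_zero] at h1
    exact h1

theorem degree_sub_lt_of_monic {p r : ℝ[X]} {n : ℕ} (hp : p.Monic) (hpn : p.natDegree = n)
    (hr : r.Monic) (hrn : r.natDegree = n) : (p - r).degree < n := by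
  have hpd : p.degree = n := by rw [degree_eq_natDegree hp.ne_zero, hpn]
  have hrd : r.degree = n := by rw [degree_eq_natDegree hr.ne_zero, hrn]
  rw [← hpd]
  exact degree_sub_lt_left (by rw [hpd, hrd]) hp.ne_zero (by rw [hp.leadingCoeff, hr.leadingCoeff])

theorem isMonicSeq_monicOrthoPoly (c : ℕ → ℝ) : IsMonicSeq (monicOrthoPoly c) := by
  intro n
  induction n using Nat.strong_induction_on with
  | _ n ih =>
    rw [monicOrthoPoly]
    set S := ∑ k : Fin n,
      C (momentFunctional c (X ^ n * monicOrthoPoly c k.1) /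
        momentFunctional c (monicOrthoPoly c k.1 * monicOrthoPoly c k.1)) *
      monicOrthoPoly c k.1 with hS
    have hd : S.degree < n := by
      refine (degree_sum_le _ _).trans_lt ?_
      rw [Finset.sup_lt_iff (by simp [bot_lt_iff_ne_bot])]
      intro k _
      rw [← smul_eq_C_mul]
      refine (degree_smul_le _ _).trans_lt ?_
      rw [degree_eq_natDegree (ih k.1 k.2).1.ne_zero, (ih k.1 k.2).2]
      exact_mod_cast k.2
    refine ⟨monic_X_pow_sub hd, ?_⟩
    rw [natDegree_eq_of_degree_eq_some]
    rw [degree_sub_eq_left_of_degree_lt] <;> simp [hd]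

/-- The squared norm of the `n`-th monic orthogonal polynomial. -/
noncomputable def orthoNorm (c : ℕ → ℝ) (n : ℕ) : ℝ :=
  momentLin c (monicOrthoPoly c n * monicOrthoPoly c n)

theorem momentLin_monicOrthoPoly_mul (c : ℕ → ℝ) (n : ℕ) (h : ∀ k < n, orthoNorm c k ≠ 0) :
    ∀ j < n, momentLin c (monicOrthoPoly c n * monicOrthoPoly c j) = 0 := by
  induction n using Nat.strong_induction_on with
  | _ n ih =>
    intro j hj
    have hkj (k : Fin n) (hk : k ≠ ⟨j, hj⟩) :
        momentLin c (monicOrthoPoly c k.1 * monicOrthoPoly c j) = 0 := by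
      rcases lt_or_gt_of_ne (fun h => hk (Fin.ext h) : k.1 ≠ j) with h1 | h1
      · rw [mul_comm]
        exact ih j hj (fun i hi => h i (hi.trans hj)) k.1 h1
      · exact ih k.1 k.2 (fun i hi => h i (hi.trans k.2)) j h1
    rw [monicOrthoPoly, sub_mul, map_sub, Finset.sum_mul, map_sum,
      Finset.sum_eq_single (⟨j, hj⟩ : Fin n)]
    · have hne := h j hj
      rw [orthoNorm] at hne
      rw [mul_assoc, momentLin_C_mul, ← momentLin_apply, ← momentLin_apply, div_mul_cancel₀ _ hne,
        sub_self]
    · intro k _ hk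
      rw [mul_assoc, momentLin_C_mul, hkj k hk, mul_zero]
    · simp

theorem momentLin_monicOrthoPoly_mul_of_degree_lt (c : ℕ → ℝ) (n : ℕ)
    (h : ∀ k < n, orthoNorm c k ≠ 0) (f : ℝ[X]) (hf : f.degree < n) :
    momentLin c (monicOrthoPoly c n * f) = 0 :=
  (isMonicSeq_monicOrthoPoly c).apply_mul_eq_zero _
    (momentLin_monicOrthoPoly_mul c n h) f hf

theorem momentLin_monicOrthoPoly_mul_monic (c : ℕ → ℝ) (n : ℕ)
    (h : ∀ k < n, orthoNorm c k ≠ 0) {f : ℝ[X]} (hf : f.Monic) (hfn : f.natDegree = n) :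
    momentLin c (monicOrthoPoly c n * f) = orthoNorm c n := by
  have hp := isMonicSeq_monicOrthoPoly c n
  have := momentLin_monicOrthoPoly_mul_of_degree_lt c n h _
    (degree_sub_lt_of_monic hf hfn hp.1 hp.2)
  rwa [mul_sub, map_sub, sub_eq_zero] at this

/-- Uniqueness: the difference of the two candidates would have some degree `m < n` and be
orthogonal to `r m`, yet that pairing is its leading coefficient times a nonzero norm. -/
theorem IsMonicSeq.monicOrthoPoly_eq {r : ℕ → ℝ[X]} (hr : IsMonicSeq r) {c : ℕ → ℝ}
    (ho : ∀ n, ∀ j < n, momentLin c (r n * r j) = 0)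
    (hn : ∀ n, momentLin c (r n * r n) ≠ 0) (n : ℕ) : monicOrthoPoly c n = r n := by
  induction n using Nat.strong_induction_on with
  | _ n ih =>
    have hp := isMonicSeq_monicOrthoPoly c
    have hnorm : ∀ k < n, orthoNorm c k ≠ 0 := fun k hk => by
      rw [orthoNorm, ih k hk]; exact hn k
    by_contra hne
    set d := monicOrthoPoly c n - r n with hd
    have hd0 : d ≠ 0 := sub_ne_zero.2 hne
    have hdn : d.degree < n := degree_sub_lt_of_monic (hp n).1 (hp n).2 (hr n).1 (hr n).2
    have hm : d.natDegree < n := (natDegree_lt_iff_degree_lt hd0).2 hdn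
    set m := d.natDegree with hmdef
    have horth : ∀ k < n, momentLin c (d * r k) = 0 := fun k hk => by
      rw [hd, sub_mul, map_sub, ho n k hk,
        momentLin_monicOrthoPoly_mul_of_degree_lt c n hnorm _ (by rw [hr.degree]; exact_mod_cast hk),
        sub_zero]
    have hlow : (d - C (d.coeff m) * r m).degree < m := by
      rw [degree_lt_iff_coeff_zero]
      intro j hj
      have h1 := (hr m).1.coeff_natDegree
      rw [(hr m).2] at h1
      rcases hj.eq_or_lt with rfl | hj
      · simp [h1]
      · have h1 : d.coeff j = 0 := coeff_eq_zero_of_natDegree_lt hj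
        have h2 : (r m).coeff j = 0 := coeff_eq_zero_of_natDegree_lt (by rw [(hr m).2]; exact hj)
        simp [h1, h2]
    have h1 := hr.apply_mul_eq_zero _ (ho m) _ hlow
    rw [mul_sub, map_sub, mul_comm, horth m hm, zero_sub, neg_eq_zero, mul_left_comm,
      momentLin_C_mul, mul_eq_zero] at h1
    rcases h1 with h1 | h1
    · exact hd0 (leadingCoeff_eq_zero.1 h1)
    · exact hn m h1

/-- `X` times the monic polynomial of degree `n` is monic of degree `n + 1`, so its pairing with the
next one is the norm of the latter. -/
theorem jacobiCoeff_eq (c : ℕ → ℝ) (n : ℕ) (h : ∀ k ≤ n, orthoNorm c k ≠ 0) :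
    jacobiCoeff c n = orthoNorm c (n + 1) /
      (Real.sqrt (orthoNorm c n) * Real.sqrt (orthoNorm c (n + 1))) := by
  have hp := isMonicSeq_monicOrthoPoly c
  have h1 := momentLin_monicOrthoPoly_mul_monic c (n + 1) (fun k hk => h k (by omega))
    (f := X * monicOrthoPoly c n) (monic_X.mul (hp n).1)
    (by rw [monic_X.natDegree_mul (hp n).1, (hp n).2, natDegree_X, add_comm])
  rw [jacobiCoeff, orthoPoly, orthoPoly, ← momentLin_apply, ← momentLin_apply, ← momentLin_apply]
  change momentLin c (X * (C (1 / Real.sqrt (orthoNorm c n)) * _) *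
    (C (1 / Real.sqrt (orthoNorm c (n + 1))) * _)) = _
  rw [show ∀ a b : ℝ, X * (C a * monicOrthoPoly c n) * (C b * monicOrthoPoly c (n + 1)) =
      C a * (C b * (monicOrthoPoly c (n + 1) * (X * monicOrthoPoly c n))) from
      fun a b => by ring, momentLin_C_mul, momentLin_C_mul, h1]
  ring

theorem sq_jacobiCoeff (c : ℕ → ℝ) (n : ℕ) (h : ∀ k ≤ n + 1, 0 < orthoNorm c k) :
    jacobiCoeff c n ^ 2 = orthoNorm c (n + 1) / orthoNorm c n := by
  have h0 := h n (by omega)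
  have h1 := h (n + 1) le_rfl
  rw [jacobiCoeff_eq c n fun k hk => (h k (by omega)).ne', div_pow, mul_pow, Real.sq_sqrt h0.le,
    Real.sq_sqrt h1.le]
  field_simp

/-! ### The case `q = 0`: Meixner–Pollaczek polynomials. -/

/-- The monic Meixner-Pollaczek polynomials, orthogonal for the moments at `q = 0`. -/
noncomputable def basePoly : ℕ → ℝ[X]
  | 0 => 1
  | 1 => X
  | n + 2 => X * basePoly (n + 1) - C (((n : ℝ) + 1) * (n + 1 / 2)) * basePoly n

theorem isMonicSeq_basePoly : IsMonicSeq basePoly := by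
  intro n
  induction n using Nat.strong_induction_on with
  | _ n ih =>
    match n, ih with
    | 0, _ => simp [basePoly]
    | 1, _ => simp [basePoly, monic_X]
    | n + 2, ih =>
      obtain ⟨h1, h2⟩ := ih (n + 1) (by omega)
      obtain ⟨h3, h4⟩ := ih n (by omega)
      have hm : (X * basePoly (n + 1)).Monic := monic_X.mul h1
      have hn : (X * basePoly (n + 1)).natDegree = n + 2 := by
        rw [monic_X.natDegree_mul h1, h2, natDegree_X]; omega
      have hd : (C (((n : ℝ) + 1) * (n + 1 / 2)) * basePoly n).degree
          < (X * basePoly (n + 1)).degree := by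
        rw [degree_eq_natDegree hm.ne_zero, hn, ← smul_eq_C_mul]
        refine (degree_smul_le _ _).trans_lt ?_
        rw [degree_eq_natDegree h3.ne_zero, h4]
        exact_mod_cast (by omega : n < n + 2)
      rw [basePoly]
      refine ⟨hm.sub_of_left hd, ?_⟩
      rw [natDegree_eq_of_degree_eq (degree_sub_eq_left_of_degree_lt hd), hn]

/-- The Pochhammer symbol `(1/2)_n`. -/
noncomputable def halfPoch (n : ℕ) : ℝ := n.factorial * absAlpha n

theorem halfPoch_zero : halfPoch 0 = 1 := by simp [halfPoch, absAlpha, alphaCoeff_zero]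

theorem halfPoch_succ (n : ℕ) : halfPoch (n + 1) = (n + 1 / 2) * halfPoch n := by
  rw [halfPoch, halfPoch, absAlpha_succ, Nat.factorial_succ]
  push_cast
  field_simp

theorem halfPoch_pos (n : ℕ) : 0 < halfPoch n :=
  mul_pos (by positivity) (absAlpha_pos n)

theorem tanOp_X_pow_succ (n : ℕ) :
    tanOp (X ^ (n + 1)) = C ((n : ℝ) + 1) * X ^ n + C ((n : ℝ) + 1 + 1 / 2) * X ^ (n + 2) := by
  rw [tanOp_apply]
  simp only [derivative_X_pow, Nat.add_sub_cancel, C_add, Nat.cast_add, Nat.cast_one,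
    map_natCast, C_1]
  ring

/-- The three-term recurrence is chosen to cancel the lower monomial in `tanOp (X^(n+1))`.
Orthogonality then becomes a statement about orders of vanishing at `0`. -/
theorem aeval_tanOp_basePoly (n : ℕ) :
    aeval tanOp (basePoly n) 1 = C (halfPoch n) * X ^ n := by
  induction n using Nat.strong_induction_on with
  | _ n ih =>
    match n, ih with
    | 0, _ => simp [basePoly, halfPoch_zero]
    | 1, _ => simp [basePoly, halfPoch_succ, halfPoch_zero, tanOp_apply]
    | n + 2, ih =>
      rw [basePoly, map_sub, map_mul, map_mul, aeval_X, aeval_C, LinearMap.sub_apply,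
        Module.End.mul_apply, Module.End.mul_apply, ih (n + 1) (by omega), ih n (by omega),
        ← smul_eq_C_mul, map_smul, tanOp_X_pow_succ, halfPoch_succ (n + 1), halfPoch_succ n,
        Module.algebraMap_end_apply, smul_eq_C_mul, smul_eq_C_mul]
      simp only [C_mul, C_add, Nat.cast_add, Nat.cast_one]
      ring

theorem momentLin_baseMoment (f : ℝ[X]) :
    momentLin baseMoment f = 1 / Real.sqrt 2 * (aeval tanOp f 1).eval 0 := by
  induction f using Polynomial.induction_on' with
  | add p q hp hq => simp only [map_add, hp, hq, LinearMap.add_apply, eval_add, mul_add]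
  | monomial n a =>
    rw [← C_mul_X_pow_eq_monomial, momentLin_C_mul, momentLin_X_pow, baseMoment, map_mul, aeval_C,
      Module.End.mul_apply, Module.algebraMap_end_apply, map_pow, aeval_X, eval_smul, smul_eq_mul]
    ring

/-- Each application of `tanOp` lowers the order of vanishing at `0` by at most one, and only the
derivative term contributes to the lowest coefficient. -/
theorem coeff_tanOp_pow_X_pow (j m : ℕ) :
    (∀ i < m, ((tanOp ^ j) (X ^ (j + m))).coeff i = 0) ∧
      ((tanOp ^ j) (X ^ (j + m))).coeff m * m.factorial = (j + m).factorial := by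
  induction j generalizing m with
  | zero =>
    simp only [pow_zero, zero_add, Module.End.one_apply, coeff_X_pow]
    exact ⟨fun i hi => if_neg hi.ne, by simp⟩
  | succ j ih =>
    obtain ⟨h1, h2⟩ := ih (m + 1)
    rw [show j + 1 + m = j + (m + 1) by omega, pow_succ', Module.End.mul_apply]
    set Q := (tanOp ^ j) (X ^ (j + (m + 1)))
    have hco (i : ℕ) (hi : i ≤ m) : (tanOp Q).coeff i = Q.coeff (i + 1) * (i + 1) := by
      have e : tanOp Q = derivative Q + X * (X * derivative Q + C (1 / 2) * Q) := by
        rw [tanOp_apply]; ring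
      rw [e, coeff_add, coeff_derivative]
      rcases i with _ | i
      · simp
      · have h0 := h1 i (by omega)
        have h3 : (X * derivative Q).coeff i = 0 := by
          rcases i with _ | i
          · simp
          · rw [coeff_X_mul, coeff_derivative, h0, zero_mul]
        rw [coeff_X_mul, coeff_add, h3, coeff_C_mul, h0]
        simp
    refine ⟨fun i hi => by rw [hco i hi.le, h1 (i + 1) (by omega), zero_mul], ?_⟩
    rw [hco m le_rfl, ← h2, Nat.factorial_succ]
    push_cast
    ring

theorem momentLin_basePoly_mul_X_pow {n j : ℕ} (hj : j < n) :
    momentLin baseMoment (basePoly n * X ^ j) = 0 := by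
  obtain ⟨m, rfl⟩ := Nat.exists_eq_add_of_lt hj
  rw [mul_comm, momentLin_baseMoment, map_mul, Module.End.mul_apply, aeval_tanOp_basePoly,
    ← smul_eq_C_mul, map_smul, aeval_X_pow, eval_smul, ← coeff_zero_eq_eval_zero, add_assoc,
    (coeff_tanOp_pow_X_pow j (m + 1)).1 0 (by omega)]
  simp

theorem momentLin_basePoly_mul_of_degree_lt (n : ℕ) (f : ℝ[X]) (hf : f.degree < n) :
    momentLin baseMoment (basePoly n * f) = 0 :=
  IsMonicSeq.apply_mul_eq_zero (r := fun k => X ^ k) (fun k => ⟨monic_X_pow k, natDegree_X_pow k⟩)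
    _ (fun _ hk => momentLin_basePoly_mul_X_pow hk) f hf

/-- The squared norm of `basePoly n`. -/
noncomputable def baseNorm (n : ℕ) : ℝ := 1 / Real.sqrt 2 * (n.factorial * halfPoch n)

theorem baseNorm_pos (n : ℕ) : 0 < baseNorm n := by
  have := halfPoch_pos n
  unfold baseNorm; positivity

theorem baseNorm_succ (n : ℕ) : baseNorm (n + 1) = (n + 1) * (n + 1 / 2) * baseNorm n := by
  rw [baseNorm, baseNorm, halfPoch_succ, Nat.factorial_succ]
  push_cast; ring

theorem momentLin_basePoly_mul_self (n : ℕ) :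
    momentLin baseMoment (basePoly n * basePoly n) = baseNorm n := by
  have h := momentLin_basePoly_mul_of_degree_lt n (basePoly n - X ^ n)
    (degree_sub_lt_of_monic (isMonicSeq_basePoly n).1 (isMonicSeq_basePoly n).2 (monic_X_pow n)
      (natDegree_X_pow n))
  rw [mul_sub, map_sub, sub_eq_zero] at h
  have h2 := (coeff_tanOp_pow_X_pow n 0).2
  rw [h, mul_comm, momentLin_baseMoment, map_mul, Module.End.mul_apply, aeval_tanOp_basePoly,
    ← smul_eq_C_mul, map_smul, aeval_X_pow, eval_smul, ← coeff_zero_eq_eval_zero]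
  simp only [add_zero, Nat.factorial_zero, Nat.cast_one, mul_one] at h2
  rw [h2, baseNorm, smul_eq_mul, mul_comm (halfPoch n)]

theorem momentLin_basePoly_mul_basePoly {n k : ℕ} (h : n ≠ k) :
    momentLin baseMoment (basePoly n * basePoly k) = 0 := by
  rcases lt_or_gt_of_ne h with h | h
  · rw [mul_comm]
    exact momentLin_basePoly_mul_of_degree_lt k _
      (by rw [isMonicSeq_basePoly.degree]; exact_mod_cast h)
  · exact momentLin_basePoly_mul_of_degree_lt n _
      (by rw [isMonicSeq_basePoly.degree]; exact_mod_cast h)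

theorem monicOrthoPoly_baseMoment (n : ℕ) : monicOrthoPoly baseMoment n = basePoly n :=
  isMonicSeq_basePoly.monicOrthoPoly_eq
    (fun _ _ hj => momentLin_basePoly_mul_basePoly hj.ne')
    (fun n => by rw [momentLin_basePoly_mul_self]; exact (baseNorm_pos n).ne') n

/-! ### Values of the base polynomials at the point masses. -/

theorem momentLin_pointMoment (l : ℕ) (f : ℝ[X]) :
    momentLin (pointMoment l) f = 2 * (aeval (Complex.I * (expRate l : ℂ)) f).re := by
  induction f using Polynomial.induction_on' with
  | add p q hp hq => simp only [map_add, hp, hq, Complex.add_re, mul_add]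
  | monomial n a =>
    rw [← C_mul_X_pow_eq_monomial, momentLin_C_mul, momentLin_X_pow, pointMoment, map_mul, aeval_C,
      map_pow, aeval_X, Complex.coe_algebraMap, Complex.re_ofReal_mul]
    ring

theorem aeval_basePoly {l : ℕ} {u : ℕ → ℝ} (h0 : u 0 = 1) (h1 : u 1 = expRate l)
    (h : ∀ n : ℕ, u (n + 2) = expRate l * u (n + 1) + (n + 1) * (n + 1 / 2) * u n) (n : ℕ) :
    aeval (Complex.I * (expRate l : ℂ)) (basePoly n) = Complex.I ^ n * (u n : ℂ) := by
  induction n using Nat.strong_induction_on with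
  | _ n ih =>
    match n, ih with
    | 0, _ => simp [basePoly, h0]
    | 1, _ => simp [basePoly, h1]
    | n + 2, ih =>
      rw [basePoly, map_sub, map_mul, map_mul, aeval_X, aeval_C, ih (n + 1) (by omega),
        ih n (by omega), h, Complex.coe_algebraMap]
      push_cast
      linear_combination (-(Complex.I ^ n * (n + 1) * (n + 1 / 2) * u n)) * Complex.I_sq

theorem aeval_basePoly_expRate_zero (n : ℕ) :
    aeval (Complex.I * (expRate 0 : ℂ)) (basePoly n) = Complex.I ^ n * (halfPoch n : ℂ) := by
  refine aeval_basePoly halfPoch_zero ?_ (fun n => ?_) n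
  · simp [halfPoch_succ, halfPoch_zero, expRate]
  · rw [halfPoch_succ (n + 1), halfPoch_succ n, expRate]
    push_cast; ring

theorem aeval_basePoly_expRate_one (n : ℕ) :
    aeval (Complex.I * (expRate 1 : ℂ)) (basePoly n) =
      Complex.I ^ n * ((halfPoch n * (4 * n + 1) : ℝ) : ℂ) := by
  refine aeval_basePoly (u := fun n => halfPoch n * (4 * n + 1)) ?_ ?_ (fun n => ?_) n
  · simp [halfPoch_zero]
  · simp [halfPoch_succ, halfPoch_zero, expRate]; norm_num
  · simp only [halfPoch_succ (n + 1), halfPoch_succ n, expRate]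
    push_cast; ring

theorem pointLin_basePoly_mul_basePoly (n k : ℕ) :
    momentLin (pointMoment 0) (basePoly n * basePoly k) =
      2 * halfPoch n * halfPoch k * (Complex.I ^ (n + k)).re := by
  rw [momentLin_pointMoment, map_mul, aeval_basePoly_expRate_zero, aeval_basePoly_expRate_zero,
    show Complex.I ^ n * (halfPoch n : ℂ) * (Complex.I ^ k * (halfPoch k : ℂ)) =
      ((halfPoch n * halfPoch k : ℝ) : ℂ) * Complex.I ^ (n + k) by push_cast; ring,
    Complex.re_ofReal_mul]
  ring

theorem I_pow_add_self_re (n : ℕ) : (Complex.I ^ (n + n)).re = (-1) ^ n := by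
  rw [← two_mul, pow_mul, Complex.I_sq, show (-1 : ℂ) = ((-1 : ℝ) : ℂ) by simp,
    ← Complex.ofReal_pow, Complex.ofReal_re]

theorem tCoeff_eq (n : ℕ) : tCoeff n = 2 * Real.sqrt 2 * ((-1) ^ n * absAlpha n) := by
  rw [tCoeff, alphaCoeff_eq]

theorem baseNorm_mul_tCoeff (n : ℕ) : baseNorm n * tCoeff n = 2 * halfPoch n ^ 2 * (-1) ^ n := by
  rw [tCoeff_eq, baseNorm, halfPoch]
  field_simp

theorem pointLin_basePoly_mul_self (n : ℕ) :
    momentLin (pointMoment 0) (basePoly n * basePoly n) = baseNorm n * tCoeff n := by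
  rw [pointLin_basePoly_mul_basePoly, I_pow_add_self_re, baseNorm_mul_tCoeff]
  ring

theorem pointLin_one_basePoly_mul_self (n : ℕ) :
    momentLin (pointMoment 1) (basePoly n * basePoly n) =
      baseNorm n * (tCoeff n * (4 * n + 1) ^ 2) := by
  rw [momentLin_pointMoment, map_mul, aeval_basePoly_expRate_one]
  generalize hv : halfPoch n * (4 * (n : ℝ) + 1) = v
  rw [show Complex.I ^ n * (v : ℂ) * (Complex.I ^ n * (v : ℂ)) =
      ((v * v : ℝ) : ℂ) * Complex.I ^ (n + n) by push_cast; ring,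
    Complex.re_ofReal_mul, I_pow_add_self_re, ← mul_assoc (baseNorm n), baseNorm_mul_tCoeff, ← hv]
  ring

theorem I_pow_re_mul_I_pow_re (n k j : ℕ) :
    (Complex.I ^ (n + k)).re * (Complex.I ^ (k + j)).re =
      if Even (n + k) then (-1) ^ k * (Complex.I ^ (n + j)).re else 0 := by
  split_ifs with h
  · obtain ⟨m, hm⟩ := h
    have h1 : Complex.I ^ (n + k) = (((Complex.I ^ (n + k)).re : ℝ) : ℂ) := by
      rw [hm, I_pow_add_self_re, ← two_mul, pow_mul, Complex.I_sq]; simp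
    have h2 : (-1 : ℝ) ^ k = (Complex.I ^ (k + k)).re := (I_pow_add_self_re k).symm
    have h3 : Complex.I ^ (k + k) = (((-1 : ℝ) ^ k : ℝ) : ℂ) := by
      rw [← two_mul, pow_mul, Complex.I_sq]; simp
    rw [← Complex.re_ofReal_mul, ← h1, ← Complex.re_ofReal_mul, ← h3, ← pow_add, ← pow_add]
    congr 2; omega
  · rw [Nat.not_even_iff_odd] at h
    obtain ⟨m, hm⟩ := h
    have : (Complex.I ^ (n + k)).re = 0 := by
      rw [hm, pow_succ, pow_mul, Complex.I_sq, show (-1 : ℂ) = ((-1 : ℝ) : ℂ) by simp,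
        ← Complex.ofReal_pow, Complex.re_ofReal_mul]
      simp
    rw [this, zero_mul]

/-- The sum of `tCoeff k` over `k < n` of the same parity as `n`. -/
noncomputable def paritySum (n : ℕ) : ℝ :=
  ∑ k ∈ Finset.range n, if Even (n + k) then tCoeff k else 0

/-- The rank-one property of the point functional: composing it with itself through the base kernel
of degree below `n` only multiplies it by the scalar `paritySum n`. -/
theorem sum_pointLin_mul_pointLin (n j : ℕ) :
    ∑ k ∈ Finset.range n, momentLin (pointMoment 0) (basePoly n * basePoly k) / baseNorm k *
        momentLin (pointMoment 0) (basePoly k * basePoly j) =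
      paritySum n * momentLin (pointMoment 0) (basePoly n * basePoly j) := by
  rw [paritySum, Finset.sum_mul]
  refine Finset.sum_congr rfl fun k _ => ?_
  have h1 := I_pow_re_mul_I_pow_re n k j
  have h2 := baseNorm_mul_tCoeff k
  have h3 := (baseNorm_pos k).ne'
  rw [pointLin_basePoly_mul_basePoly, pointLin_basePoly_mul_basePoly,
    pointLin_basePoly_mul_basePoly, div_mul_eq_mul_div, div_eq_iff h3]
  split_ifs at h1 ⊢
  · linear_combination (4 * halfPoch n * halfPoch k ^ 2 * halfPoch j) * h1 -
      2 * halfPoch n * halfPoch j * (Complex.I ^ (n + j)).re * h2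
  · linear_combination (4 * halfPoch n * halfPoch k ^ 2 * halfPoch j) * h1

/-! ### Exact solution of the rank-one perturbation. -/

theorem momentLin_add (c d : ℕ → ℝ) (f : ℝ[X]) :
    momentLin (fun j => c j + d j) f = momentLin c f + momentLin d f := by
  simp only [momentLin_eq_sum_range _ le_rfl, mul_add, Finset.sum_add_distrib]

theorem momentLin_const_mul (a : ℝ) (c : ℕ → ℝ) (f : ℝ[X]) :
    momentLin (fun j => a * c j) f = a * momentLin c f := by
  simp only [momentLin_eq_sum_range _ le_rfl, Finset.mul_sum, mul_left_comm]

/-- The moments at `q = 0` perturbed by `ε` times the point masses at `± i / 2`. -/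
noncomputable def tiltMoment (ε : ℝ) (j : ℕ) : ℝ := baseMoment j + ε * pointMoment 0 j

theorem momentLin_tiltMoment (ε : ℝ) (f : ℝ[X]) :
    momentLin (tiltMoment ε) f = momentLin baseMoment f + ε * momentLin (pointMoment 0) f := by
  rw [← momentLin_const_mul, ← momentLin_add]
  rfl

/-- The coefficients of `tiltPoly` with respect to `basePoly`. -/
noncomputable def tiltCoeff (ε : ℝ) (n k : ℕ) : ℝ :=
  ε / (1 + ε * paritySum n) *
    (momentLin (pointMoment 0) (basePoly n * basePoly k) / baseNorm k)

/-- The monic orthogonal polynomials for `tiltMoment`. -/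
noncomputable def tiltPoly (ε : ℝ) (n : ℕ) : ℝ[X] :=
  basePoly n - ∑ k ∈ Finset.range n, C (tiltCoeff ε n k) * basePoly k

theorem degree_sum_C_mul_basePoly_lt (n : ℕ) (a : ℕ → ℝ) :
    (∑ k ∈ Finset.range n, C (a k) * basePoly k).degree < n := by
  refine (degree_sum_le _ _).trans_lt ?_
  rw [Finset.sup_lt_iff (by simp [bot_lt_iff_ne_bot])]
  intro k hk
  rw [← smul_eq_C_mul]
  refine (degree_smul_le _ _).trans_lt ?_
  rw [isMonicSeq_basePoly.degree]
  exact_mod_cast Finset.mem_range.1 hk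

theorem isMonicSeq_tiltPoly (ε : ℝ) : IsMonicSeq (tiltPoly ε) := by
  intro n
  have hd : (∑ k ∈ Finset.range n, C (tiltCoeff ε n k) * basePoly k).degree
      < (basePoly n).degree := by
    rw [isMonicSeq_basePoly.degree]
    exact degree_sum_C_mul_basePoly_lt n _
  refine ⟨(isMonicSeq_basePoly n).1.sub_of_left hd, ?_⟩
  rw [tiltPoly, natDegree_eq_of_degree_eq (degree_sub_eq_left_of_degree_lt hd),
    (isMonicSeq_basePoly n).2]

theorem tiltPoly_zero (n : ℕ) : tiltPoly 0 n = basePoly n := by simp [tiltPoly, tiltCoeff]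

/-- A Sherman–Morrison computation: by rank one, the correction replaces the factor `ε` by `ε (1 - ε
s/(1 + ε s)) = ε/(1 + ε s)`. -/
theorem momentLin_tiltPoly_mul_basePoly {ε : ℝ} {n : ℕ} (hε : 1 + ε * paritySum n ≠ 0) (j : ℕ) :
    momentLin (tiltMoment ε) (tiltPoly ε n * basePoly j) =
      momentLin baseMoment (tiltPoly ε n * basePoly j) +
        ε / (1 + ε * paritySum n) * momentLin (pointMoment 0) (basePoly n * basePoly j) := by
  rw [momentLin_tiltMoment]
  congr 1
  have h : ∑ k ∈ Finset.range n, tiltCoeff ε n k *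
      momentLin (pointMoment 0) (basePoly k * basePoly j) = ε / (1 + ε * paritySum n) *
        (paritySum n * momentLin (pointMoment 0) (basePoly n * basePoly j)) := by
    rw [← sum_pointLin_mul_pointLin, Finset.mul_sum]
    refine Finset.sum_congr rfl fun k _ => ?_
    rw [tiltCoeff, mul_assoc]
  rw [tiltPoly, sub_mul, map_sub, Finset.sum_mul, map_sum]
  simp only [mul_assoc (C _), momentLin_C_mul]
  rw [h]
  field_simp
  ring

theorem momentLin_tiltPoly_mul_of_lt {ε : ℝ} {n : ℕ} (hε : 1 + ε * paritySum n ≠ 0) {j : ℕ}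
    (hj : j < n) : momentLin (tiltMoment ε) (tiltPoly ε n * basePoly j) = 0 := by
  have hn := (baseNorm_pos j).ne'
  rw [momentLin_tiltPoly_mul_basePoly hε, tiltPoly, sub_mul, map_sub, Finset.sum_mul, map_sum,
    Finset.sum_eq_single_of_mem j (Finset.mem_range.2 hj), mul_assoc, momentLin_C_mul,
    momentLin_basePoly_mul_self, momentLin_basePoly_mul_basePoly hj.ne', tiltCoeff]
  · field_simp
    ring
  · intro k _ hk
    rw [mul_assoc, momentLin_C_mul, momentLin_basePoly_mul_basePoly hk, mul_zero]

theorem momentLin_tiltPoly_mul_of_degree_lt {ε : ℝ} {n : ℕ} (hε : 1 + ε * paritySum n ≠ 0)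
    (f : ℝ[X]) (hf : f.degree < n) : momentLin (tiltMoment ε) (tiltPoly ε n * f) = 0 :=
  isMonicSeq_basePoly.apply_mul_eq_zero _ (fun _ hj => momentLin_tiltPoly_mul_of_lt hε hj) f hf

theorem momentLin_tiltPoly_mul_monic {ε : ℝ} {n : ℕ} (hε : 1 + ε * paritySum n ≠ 0)
    {f : ℝ[X]} (hf : f.Monic) (hfn : f.natDegree = n) :
    momentLin (tiltMoment ε) (tiltPoly ε n * f) =
      baseNorm n * (1 + ε * tCoeff n * (1 + ε * paritySum n)⁻¹) := by
  have h := momentLin_tiltPoly_mul_of_degree_lt hε _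
    (degree_sub_lt_of_monic hf hfn (isMonicSeq_basePoly n).1 (isMonicSeq_basePoly n).2)
  rw [mul_sub, map_sub, sub_eq_zero] at h
  rw [h, momentLin_tiltPoly_mul_basePoly hε, pointLin_basePoly_mul_self, mul_comm (tiltPoly ε n),
    tiltPoly, mul_sub, map_sub, momentLin_basePoly_mul_of_degree_lt n _
      (degree_sum_C_mul_basePoly_lt n _), momentLin_basePoly_mul_self]
  field_simp
  ring

/-! ### Analytic dependence on `q` and the norms modulo `q^4`. -/

/-- A family of polynomials of bounded degree, with coefficients analytic at `0`. -/
def AnalyticFamily (P : ℝ → ℝ[X]) : Prop :=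
  (∃ N, ∀ q, (P q).natDegree ≤ N) ∧ ∀ i, AnalyticAt ℝ (fun q => (P q).coeff i) 0

namespace AnalyticFamily

variable {P Q : ℝ → ℝ[X]}

theorem const (p : ℝ[X]) : AnalyticFamily fun _ => p :=
  ⟨⟨_, fun _ => le_rfl⟩, fun _ => analyticAt_const⟩

theorem C_of_analyticAt {a : ℝ → ℝ} (ha : AnalyticAt ℝ a 0) : AnalyticFamily fun q => C (a q) := by
  refine ⟨⟨0, fun q => by simp⟩, fun i => ?_⟩
  rcases i with _ | i
  · simpa using ha
  · simpa [coeff_C] using! analyticAt_const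

theorem mul (hP : AnalyticFamily P) (hQ : AnalyticFamily Q) :
    AnalyticFamily fun q => P q * Q q := by
  obtain ⟨⟨N, hN⟩, hP⟩ := hP
  obtain ⟨⟨M, hM⟩, hQ⟩ := hQ
  refine ⟨⟨N + M, fun q => natDegree_mul_le.trans (add_le_add (hN q) (hM q))⟩, fun i => ?_⟩
  simp only [coeff_mul]
  exact Finset.analyticAt_fun_sum _ fun x _ => (hP x.1).mul (hQ x.2)

theorem sub (hP : AnalyticFamily P) (hQ : AnalyticFamily Q) :
    AnalyticFamily fun q => P q - Q q := by
  obtain ⟨⟨N, hN⟩, hP⟩ := hP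
  obtain ⟨⟨M, hM⟩, hQ⟩ := hQ
  refine ⟨⟨max N M, fun q => (natDegree_sub_le _ _).trans (max_le_max (hN q) (hM q))⟩,
    fun i => ?_⟩
  simp only [coeff_sub]
  exact (hP i).sub (hQ i)

theorem sum {ι : Type*} (s : Finset ι) {R : ι → ℝ → ℝ[X]} (h : ∀ i ∈ s, AnalyticFamily (R i)) :
    AnalyticFamily fun q => ∑ i ∈ s, R i q := by
  choose! N hN using fun i hi => (h i hi).1
  refine ⟨⟨s.sup N, fun q => natDegree_sum_le_of_forall_le _ _ fun i hi =>
    (hN i hi q).trans (Finset.le_sup hi)⟩, fun j => ?_⟩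
  simp only [finsetSum_coeff]
  exact Finset.analyticAt_fun_sum _ fun i hi => (h i hi).2 j

theorem momentLin_moment (hP : AnalyticFamily P) :
    AnalyticAt ℝ (fun q => momentLin (moment q) (P q)) 0 := by
  obtain ⟨⟨N, hN⟩, hP⟩ := hP
  simp only [fun q => momentLin_eq_sum_range (moment q) (hN q)]
  exact Finset.analyticAt_fun_sum _ fun i _ => (hP i).mul (analyticAt_moment i)

end AnalyticFamily

theorem moment_zero_eq : moment 0 = baseMoment := funext moment_zero

theorem analyticFamily_monicOrthoPoly (n : ℕ) :
    AnalyticFamily fun q => monicOrthoPoly (moment q) n := by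
  induction n using Nat.strong_induction_on with
  | _ n ih =>
    have he : (fun q => monicOrthoPoly (moment q) n) = fun q => X ^ n - ∑ k : Fin n,
        C (momentLin (moment q) (X ^ n * monicOrthoPoly (moment q) k.1) /
          momentLin (moment q) (monicOrthoPoly (moment q) k.1 * monicOrthoPoly (moment q) k.1)) *
          monicOrthoPoly (moment q) k.1 := by
      funext q
      rw [monicOrthoPoly]
      simp only [momentLin_apply]
    rw [he]
    refine (AnalyticFamily.const _).sub (AnalyticFamily.sum _ fun k _ => ?_)
    have hk := ih k.1 k.2
    refine (AnalyticFamily.C_of_analyticAt ?_).mul hk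
    refine ((AnalyticFamily.const _).mul hk).momentLin_moment.div
      (hk.mul hk).momentLin_moment ?_
    rw [moment_zero_eq, monicOrthoPoly_baseMoment, momentLin_basePoly_mul_self]
    exact (baseNorm_pos _).ne'

theorem analyticAt_orthoNorm (n : ℕ) : AnalyticAt ℝ (fun q => orthoNorm (moment q) n) 0 :=
  ((analyticFamily_monicOrthoPoly n).mul (analyticFamily_monicOrthoPoly n)).momentLin_moment

theorem orthoNorm_moment_zero (n : ℕ) : orthoNorm (moment 0) n = baseNorm n := by
  rw [orthoNorm, moment_zero_eq, monicOrthoPoly_baseMoment, momentLin_basePoly_mul_self]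

theorem eventually_orthoNorm_pos (n : ℕ) :
    ∀ᶠ q in 𝓝 (0 : ℝ), ∀ k ≤ n, 0 < orthoNorm (moment q) k := by
  have h (k : ℕ) : ∀ᶠ q in 𝓝 (0 : ℝ), 0 < orthoNorm (moment q) k := by
    refine (analyticAt_orthoNorm k).continuousAt.eventually_const_lt ?_
    simpa only [orthoNorm_moment_zero] using baseNorm_pos k
  exact (eventually_all_finite (Set.finite_Iic n)).2 fun k _ => h k

/-- A truncation of `q / (1 - q)`. -/
def tiltParam (q : ℝ) : ℝ := q + q ^ 2 + q ^ 3

theorem analyticAt_tiltParam : AnalyticAt ℝ tiltParam 0 := by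
  unfold tiltParam
  fun_prop

theorem tiltParam_zero : tiltParam 0 = 0 := by simp [tiltParam]

theorem analyticFamily_tiltPoly (n : ℕ) : AnalyticFamily fun q => tiltPoly (tiltParam q) n := by
  unfold tiltPoly
  refine (AnalyticFamily.const _).sub (AnalyticFamily.sum _ fun k _ => ?_)
  refine (AnalyticFamily.C_of_analyticAt ?_).mul (AnalyticFamily.const _)
  unfold tiltCoeff
  refine (analyticAt_tiltParam.div ?_ ?_).mul analyticAt_const
  · exact analyticAt_const.add (analyticAt_tiltParam.mul analyticAt_const)
  · simp [tiltParam_zero]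

/-- The `μ_1` term already carries `q³`, so replacing `P q` by `P 0` there costs only `O(q^4)`. -/
theorem AnalyticFamily.isBigO_momentLin_sub {P : ℝ → ℝ[X]} (hP : AnalyticFamily P) :
    (fun q => momentLin (moment q) (P q) - momentLin (tiltMoment (tiltParam q)) (P q) -
      alphaCoeff 1 * momentLin (pointMoment 1) (P 0) * q ^ 3) =O[𝓝 0] fun q => q ^ 4 := by
  obtain ⟨⟨N, hN⟩, hP⟩ := hP
  simp only [fun q => momentLin_eq_sum_range (moment q) (hN q),
    fun q => momentLin_eq_sum_range (tiltMoment (tiltParam q)) (hN q),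
    momentLin_eq_sum_range (pointMoment 1) (hN 0)]
  have hsum : (fun q : ℝ => ∑ j ∈ Finset.range (N + 1),
      ((P q).coeff j * (moment q j - (baseMoment j + (q + q ^ 2 + q ^ 3) * pointMoment 0 j) -
        alphaCoeff 1 * q ^ 3 * pointMoment 1 j) +
        alphaCoeff 1 * pointMoment 1 j * (((P q).coeff j - (P 0).coeff j) * q ^ 3)))
      =O[𝓝 0] fun q => q ^ 4 := by
    refine Asymptotics.IsBigO.fun_sum (g := fun q : ℝ => q ^ 4) fun j _ => ?_
    apply Asymptotics.IsBigO.add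
    · have h1 : (fun q => (P q).coeff j) =O[𝓝 0] fun _ => (1 : ℝ) :=
        (hP j).continuousAt.tendsto.isBigO_one ℝ
      simpa using h1.mul (moment_isBigO j)
    · apply Asymptotics.IsBigO.const_mul_left
      have h1 : (fun q => (P q).coeff j - (P 0).coeff j) =O[𝓝 0] fun q => q := by
        have := (hP j).differentiableAt.hasFDerivAt.isBigO_sub
        simpa only [sub_zero] using this
      refine (h1.mul (Asymptotics.isBigO_refl (fun q : ℝ => q ^ 3) _)).congr_right fun q => ?_
      ring
  refine hsum.congr_left fun q => ?_
  rw [Finset.mul_sum, Finset.sum_mul, ← Finset.sum_sub_distrib, ← Finset.sum_sub_distrib]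
  refine Finset.sum_congr rfl fun j _ => ?_
  rw [tiltMoment, tiltParam]
  ring

/-- Apply both functionals to the mixed product of the true and the tilted monic polynomial. By
orthogonality each returns its own exact norm, so the variation of the polynomials need not be
expanded. -/
theorem isBigO_orthoNorm (n : ℕ) :
    (fun q => orthoNorm (moment q) n -
        baseNorm n * (1 + tiltParam q * tCoeff n * (1 + tiltParam q * paritySum n)⁻¹) -
      alphaCoeff 1 * (baseNorm n * (tCoeff n * (4 * n + 1) ^ 2)) * q ^ 3)
      =O[𝓝 0] fun q => q ^ 4 := by
  have h := ((analyticFamily_monicOrthoPoly n).mul (analyticFamily_tiltPoly n)).isBigO_momentLin_sub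
  simp only [tiltParam_zero, tiltPoly_zero, moment_zero_eq, monicOrthoPoly_baseMoment,
    pointLin_one_basePoly_mul_self] at h
  refine h.congr' ?_ EventuallyEq.rfl
  have hne : ∀ᶠ q in 𝓝 (0 : ℝ), 1 + tiltParam q * paritySum n ≠ 0 := by
    have hc : ContinuousAt (fun q => 1 + tiltParam q * paritySum n) 0 := by
      have := analyticAt_tiltParam.continuousAt
      fun_prop
    refine hc.eventually_ne ?_
    simp [tiltParam_zero]
  filter_upwards [hne, eventually_orthoNorm_pos n] with q hq hpos
  have hp := isMonicSeq_monicOrthoPoly (moment q) n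
  have ht := isMonicSeq_tiltPoly (tiltParam q) n
  rw [momentLin_monicOrthoPoly_mul_monic _ n (fun k hk => (hpos k hk.le).ne') ht.1 ht.2,
    mul_comm (monicOrthoPoly _ _), momentLin_tiltPoly_mul_monic hq hp.1 hp.2]

/-! ### Parity sums and the hypergeometric value. -/

theorem paritySum_add_two (n : ℕ) : paritySum (n + 2) = paritySum n + tCoeff n := by
  have h1 : ¬ Even (n + 2 + (n + 1)) := by
    rw [show n + 2 + (n + 1) = 2 * (n + 1) + 1 by ring]; simp
  have h2 : Even (n + 2 + n) := ⟨n + 1, by ring⟩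
  rw [paritySum, Finset.sum_range_succ, Finset.sum_range_succ, paritySum, if_neg h1, if_pos h2,
    add_zero]
  congr 1
  refine Finset.sum_congr rfl fun k _ => ?_
  simp [parity_simps]

theorem tCoeff_succ (n : ℕ) : tCoeff (n + 1) = -((n : ℝ) + 1 / 2) / (n + 1) * tCoeff n := by
  rw [tCoeff, tCoeff, alphaCoeff_succ]; ring

theorem paritySum_zero : paritySum 0 = 0 := by simp [paritySum]

theorem paritySum_one : paritySum 1 = 0 := by simp [paritySum]

/-- The alternating sum telescopes because `2(n+1) t(n+1) = -(2n+1) t(n)`. -/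
theorem paritySum_succ_sub (n : ℕ) : paritySum (n + 1) - paritySum n = -2 * n * tCoeff n := by
  induction n with
  | zero => simp [paritySum_zero, paritySum_one]
  | succ n ih =>
    rw [paritySum_add_two, tCoeff_succ]
    push_cast
    field_simp
    linear_combination -ih

theorem paritySum_add_paritySum_succ (n : ℕ) :
    paritySum n + paritySum (n + 1) = ∑ k ∈ Finset.range n, tCoeff k := by
  induction n with
  | zero => simp [paritySum_zero, paritySum_one]
  | succ n ih =>
    rw [paritySum_add_two, Finset.sum_range_succ, ← ih]
    ring

/-- The terms `(-1)^k (n+1/2)_k/(n+1)_k` satisfy the recursion of `α_{n+k}`, so the series is a tail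
of `∑ α_k`. -/
theorem ordinaryHypergeometricCoefficient_mul_neg_one_pow (n k : ℕ) :
    ordinaryHypergeometricCoefficient 1 ((n : ℝ) + 1 / 2) ((n : ℝ) + 1) k * (-1) ^ k =
      alphaCoeff (n + k) / alphaCoeff n := by
  have hk : (k.factorial : ℝ) ≠ 0 := by positivity
  simp only [ordinaryHypergeometricCoefficient, ascPochhammer_eval_one]
  rw [inv_mul_cancel₀ hk, one_mul]
  clear hk
  induction k with
  | zero => simp [div_self (alphaCoeff_ne_zero n)]
  | succ k ih =>
    have h : alphaCoeff (n + (k + 1)) / alphaCoeff n =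
        alphaCoeff (n + k) / alphaCoeff n * (-((n : ℝ) + k + 1 / 2) / (n + k + 1)) := by
      rw [← add_assoc, alphaCoeff_succ]
      push_cast; ring
    rw [h, ← ih, ascPochhammer_succ_eval, ascPochhammer_succ_eval, mul_inv, pow_succ]
    ring

/-- The value of the hypergeometric series `₂F₁(1, n + 1/2; n + 1; -1)`. -/
noncomputable def hypergeometricY (n : ℕ) : ℝ :=
  (1 / Real.sqrt 2 - ∑ k ∈ Finset.range n, alphaCoeff k) / alphaCoeff n

theorem isHypergeometricValue_hypergeometricY (n : ℕ) :
    IsHypergeometricValue 1 ((n : ℝ) + 1 / 2) ((n : ℝ) + 1) (-1) (hypergeometricY n) := by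
  have h := (((tendsto_add_atTop_iff_nat n).2 tendsto_sum_alphaCoeff).sub_const
    (∑ k ∈ Finset.range n, alphaCoeff k)).div_const (alphaCoeff n)
  refine h.congr fun K => ?_
  simp only [ordinaryHypergeometricCoefficient_mul_neg_one_pow]
  rw [add_comm K n, Finset.sum_range_add, add_sub_cancel_left, Finset.sum_div]

theorem tCoeff_mul_hypergeometricY (n : ℕ) :
    tCoeff n * hypergeometricY n = 2 - (paritySum n + paritySum (n + 1)) := by
  have h2 : Real.sqrt 2 * (1 / Real.sqrt 2) = 1 := mul_one_div_cancel (by positivity)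
  rw [paritySum_add_paritySum_succ]
  simp only [tCoeff, ← Finset.mul_sum]
  rw [hypergeometricY, mul_assoc, mul_div_cancel₀ _ (alphaCoeff_ne_zero n)]
  linear_combination 2 * h2

/-! ### Arithmetic and uniqueness of cubic jets. -/

/-- `f` agrees with `a + b q + c q² + d q³` up to `O(q⁴)` at `0`. -/
def HasCubicJet (f : ℝ → ℝ) (a b c d : ℝ) : Prop :=
  (fun q => f q - (a + b * q + c * q ^ 2 + d * q ^ 3)) =O[𝓝 0] fun q => q ^ 4

namespace HasCubicJet

variable {f g : ℝ → ℝ} {a b c d a' b' c' d' : ℝ}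

theorem of_eventuallyEq (h : f =ᶠ[𝓝 0] fun q => a + b * q + c * q ^ 2 + d * q ^ 3) :
    HasCubicJet f a b c d := by
  refine (Asymptotics.isBigO_zero (E' := ℝ) _ _).congr' ?_ EventuallyEq.rfl
  filter_upwards [h] with q hq
  rw [hq, sub_self]

theorem congr (hf : HasCubicJet f a b c d) (h : f =ᶠ[𝓝 0] g) : HasCubicJet g a b c d := by
  refine Asymptotics.IsBigO.congr' hf ?_ EventuallyEq.rfl
  filter_upwards [h] with q hq
  rw [hq]

theorem add (hf : HasCubicJet f a b c d) (hg : HasCubicJet g a' b' c' d') :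
    HasCubicJet (fun q => f q + g q) (a + a') (b + b') (c + c') (d + d') :=
  (Asymptotics.IsBigO.add hf hg).congr_left fun q => by ring

theorem const_mul (r : ℝ) (hf : HasCubicJet f a b c d) :
    HasCubicJet (fun q => r * f q) (r * a) (r * b) (r * c) (r * d) :=
  (Asymptotics.IsBigO.const_mul_left hf r).congr_left fun q => by ring

theorem sub (hf : HasCubicJet f a b c d) (hg : HasCubicJet g a' b' c' d') :
    HasCubicJet (fun q => f q - g q) (a - a') (b - b') (c - c') (d - d') :=
  (Asymptotics.IsBigO.sub hf hg).congr_left fun q => by ring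

theorem tendsto (hf : HasCubicJet f a b c d) : Tendsto f (𝓝 0) (𝓝 a) := by
  have h1 : Tendsto (fun q : ℝ => q ^ 4) (𝓝 0) (𝓝 0) := by
    have : ContinuousAt (fun q : ℝ => q ^ 4) 0 := by fun_prop
    simpa [ContinuousAt] using this
  have h2 := Asymptotics.IsBigO.trans_tendsto hf h1
  have h3 : Tendsto (fun q : ℝ => a + b * q + c * q ^ 2 + d * q ^ 3) (𝓝 0) (𝓝 a) := by
    have : ContinuousAt (fun q : ℝ => a + b * q + c * q ^ 2 + d * q ^ 3) 0 := by fun_prop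
    simpa [ContinuousAt] using this
  simpa using h2.add h3

theorem mul (hf : HasCubicJet f a b c d) (hg : HasCubicJet g a' b' c' d') :
    HasCubicJet (fun q => f q * g q) (a * a') (a * b' + b * a') (a * c' + b * b' + c * a')
      (a * d' + b * c' + c * b' + d * a') := by
  have h1 := Asymptotics.IsBigO.mul hf (hg.tendsto.isBigO_one ℝ)
  have hp : (fun q : ℝ => a + b * q + c * q ^ 2 + d * q ^ 3) =O[𝓝 0] fun _ => (1 : ℝ) :=
    Tendsto.isBigO_one (c := a) ℝ (of_eventuallyEq EventuallyEq.rfl).tendsto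
  have h2 := hp.mul hg
  have hr : (fun q : ℝ => (b * d' + c * c' + d * b') + (c * d' + d * c') * q + d * d' * q ^ 2
      + 0 * q ^ 3) =O[𝓝 0] fun _ => (1 : ℝ) :=
    Tendsto.isBigO_one ℝ (of_eventuallyEq EventuallyEq.rfl).tendsto
  have h3 := hr.mul (Asymptotics.isBigO_refl (fun q : ℝ => q ^ 4) (𝓝 0))
  simp only [mul_one, one_mul] at h1 h2 h3
  exact ((h1.add h2).add h3).congr_left fun q => by ring

/-- The product of `f` with the candidate polynomial is `1 + O(q^4)`, and `f⁻¹` is bounded near `0`.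
-/
theorem inv (hf : HasCubicJet f 1 b c d) :
    HasCubicJet (fun q => (f q)⁻¹) 1 (-b) (b ^ 2 - c) (-b ^ 3 + 2 * b * c - d) := by
  have hr : HasCubicJet (fun q : ℝ => 1 + (-b) * q + (b ^ 2 - c) * q ^ 2 +
      (-b ^ 3 + 2 * b * c - d) * q ^ 3) 1 (-b) (b ^ 2 - c) (-b ^ 3 + 2 * b * c - d) :=
    of_eventuallyEq EventuallyEq.rfl
  have hm := hf.mul hr
  have hi : (fun q => (f q)⁻¹) =O[𝓝 0] fun _ => (1 : ℝ) :=
    (hf.tendsto.inv₀ one_ne_zero).isBigO_one ℝ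
  have h1 := hi.mul (Asymptotics.IsBigO.neg_left hm)
  simp only [one_mul] at h1
  refine h1.congr' ?_ EventuallyEq.rfl
  filter_upwards [hf.tendsto.eventually_ne one_ne_zero] with q hq
  field_simp
  ring

end HasCubicJet

/-- One step of comparing coefficients; the punctured neighbourhood permits division by `q`. -/
theorem eq_zero_of_add_mul_isBigO {a : ℝ} {g : ℝ → ℝ} {n : ℕ} (hg : ContinuousAt g 0)
    (h : (fun q => a + q * g q) =O[𝓝[≠] 0] fun q => q ^ (n + 1)) :
    a = 0 ∧ g =O[𝓝[≠] 0] fun q => q ^ n := by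
  have ha : a = 0 := by
    have h1 : Tendsto (fun q : ℝ => q ^ (n + 1)) (𝓝[≠] 0) (𝓝 0) := by
      have : ContinuousAt (fun q : ℝ => q ^ (n + 1)) 0 := by fun_prop
      simpa [ContinuousAt] using this.tendsto.mono_left nhdsWithin_le_nhds
    have h2 : Tendsto (fun q : ℝ => a + q * g q) (𝓝[≠] 0) (𝓝 a) := by
      have : ContinuousAt (fun q : ℝ => a + q * g q) 0 := by fun_prop
      simpa [ContinuousAt] using this.tendsto.mono_left nhdsWithin_le_nhds
    exact tendsto_nhds_unique h2 (h.trans_tendsto h1)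
  refine ⟨ha, ?_⟩
  have h3 := (Asymptotics.isBigO_refl (fun q : ℝ => q⁻¹) (𝓝[≠] 0)).mul h
  refine h3.congr' ?_ ?_
  · filter_upwards [self_mem_nhdsWithin] with q hq
    have : q ≠ 0 := hq
    rw [ha, zero_add, inv_mul_cancel_left₀ this]
  · filter_upwards [self_mem_nhdsWithin] with q hq
    have : q ≠ 0 := hq
    rw [pow_succ', inv_mul_cancel_left₀ this]

theorem HasCubicJet.eq_coeff_three {f : ℝ → ℝ} {a b c d : ℝ} (hf : HasCubicJet f a b c d)
    {p : FormalMultilinearSeries ℝ ℝ ℝ} (hp : HasFPowerSeriesAt f p 0) : p.coeff 3 = d := by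
  have hp4 : HasCubicJet f (p.coeff 0) (p.coeff 1) (p.coeff 2) (p.coeff 3) := by
    have h := (hp.isBigO_sub_partialSum_pow 4).norm_right
    simp only [zero_add, FormalMultilinearSeries.partialSum, Finset.sum_range_succ,
      Finset.sum_range_zero, FormalMultilinearSeries.apply_eq_pow_smul_coeff, smul_eq_mul,
      norm_pow, norm_norm] at h
    simp only [← norm_pow] at h
    refine (Asymptotics.isBigO_norm_right.1 h).congr_left fun q => ?_
    ring
  have h := Asymptotics.IsBigO.mono (hp4.sub hf) (nhdsWithin_le_nhds (s := {0}ᶜ))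
  simp only [sub_self, zero_sub] at h
  set A := p.coeff 0 - a
  set B := p.coeff 1 - b
  set E := p.coeff 2 - c
  set D := p.coeff 3 - d with hD
  have h0 : (fun q => A + q * (B + q * (E + q * D))) =O[𝓝[≠] 0] fun q : ℝ => q ^ 4 :=
    h.neg_left.congr_left fun q => by ring
  obtain ⟨-, h1⟩ := eq_zero_of_add_mul_isBigO (by fun_prop) h0
  obtain ⟨-, h2⟩ := eq_zero_of_add_mul_isBigO (by fun_prop) h1
  obtain ⟨-, h3⟩ := eq_zero_of_add_mul_isBigO (by fun_prop) h2
  have h4 := (eq_zero_of_add_mul_isBigO (a := D) (g := fun _ => (0 : ℝ)) (n := 0) (by fun_prop)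
    (h3.congr_left fun q => by ring)).1
  linarith

theorem hasCubicJet_orthoNorm (n : ℕ) :
    HasCubicJet (fun q => (baseNorm n)⁻¹ * orthoNorm (moment q) n) 1 (tCoeff n)
      (tCoeff n - tCoeff n * paritySum n)
      (tCoeff n - 2 * tCoeff n * paritySum n + tCoeff n * paritySum n ^ 2 -
        1 / 2 * (tCoeff n * (4 * n + 1) ^ 2)) := by
  have he : HasCubicJet tiltParam 0 1 1 1 :=
    .of_eventuallyEq (.of_forall fun q => by rw [tiltParam]; ring)
  have hone : HasCubicJet (fun _ => 1) 1 0 0 0 :=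
    .of_eventuallyEq (.of_forall fun q => by ring)
  have hs := hone.add (he.const_mul (paritySum n))
  rw [mul_zero, add_zero] at hs
  have h1 := (hone.add ((he.mul hs.inv).const_mul (tCoeff n)))
  have h2 : HasCubicJet (fun q => q ^ 3) 0 0 0 1 :=
    .of_eventuallyEq (.of_forall fun q => by ring)
  have h3 := h1.add (h2.const_mul (alphaCoeff 1 * (tCoeff n * (4 * n + 1) ^ 2)))
  have h4 := (Asymptotics.IsBigO.const_mul_left (isBigO_orthoNorm n) (baseNorm n)⁻¹)
  have hne := (baseNorm_pos n).ne'
  refine (Asymptotics.IsBigO.add h4 h3).congr_left fun q => ?_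
  beta_reduce
  rw [alphaCoeff_one, mul_comm (paritySum n) (tiltParam q)]
  generalize (1 + tiltParam q * paritySum n)⁻¹ = w
  field_simp
  ring

/-! ### The diagonal of `D` in terms of the Jacobi coefficients. -/

theorem jacobiOp_single (a : ℕ → ℝ) (n : ℕ) : jacobiOp a (Finsupp.single n 1) =
    (if n = 0 then 0 else Finsupp.single (n - 1) (a (n - 1) : ℂ)) +
      Finsupp.single (n + 1) (a n : ℂ) := by
  simp [jacobiOp, Finsupp.linearCombination_single]

theorem gradingOp_single (n : ℕ) (z : ℂ) :
    gradingOp (Finsupp.single n z) = (n : ℂ) • Finsupp.single n z := by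
  simp [gradingOp, Finsupp.linearCombination_single, mul_comm]

theorem jacobiOp_single_apply (a : ℕ → ℝ) (n j : ℕ) : jacobiOp a (Finsupp.single n 1) j =
    if n = j + 1 then (a j : ℂ) else if j = n + 1 then (a n : ℂ) else 0 := by
  rw [jacobiOp_single, Finsupp.add_apply]
  rcases n with _ | n
  · simp [Finsupp.single_apply, eq_comm]
  · by_cases h : n = j
    · subst h
      have h : n + 1 + 1 ≠ n := by omega
      simp [h]
    · by_cases h2 : j = n + 1 + 1
      · subst h2
        have h : n ≠ n + 1 + 1 := by omega
        simp [h]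
      · simp [h, h2]

theorem one_div_two_mul_I : 1 / (2 * Complex.I) = -(Complex.I / 2) := by
  field_simp
  simp

theorem ePlus_single_zero (a : ℕ → ℝ) : ePlus a (Finsupp.single 0 1) =
    (1 / 4 : ℂ) • Finsupp.single 0 1 + (Complex.I / 2 * a 0) • Finsupp.single 1 1 := by
  simp only [ePlus, LinearMap.add_apply, LinearMap.smul_apply, Module.End.one_apply,
    Ring.lie_def, LinearMap.sub_apply, Module.End.mul_apply, gradingOp_single, map_smul,
    jacobiOp_single, map_add, if_pos, one_div_two_mul_I]
  ext k
  simp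

theorem ePlus_single_succ (a : ℕ → ℝ) (n : ℕ) : ePlus a (Finsupp.single (n + 1) 1) =
    (1 / 4 + ((n : ℂ) + 1)) • Finsupp.single (n + 1) 1 -
      (Complex.I / 2 * a n) • Finsupp.single n 1 +
      (Complex.I / 2 * a (n + 1)) • Finsupp.single (n + 2) 1 := by
  simp only [ePlus, LinearMap.add_apply, LinearMap.smul_apply, Module.End.one_apply,
    Ring.lie_def, LinearMap.sub_apply, Module.End.mul_apply, gradingOp_single, map_smul,
    jacobiOp_single, map_add, if_neg (Nat.succ_ne_zero n), Nat.add_sub_cancel, one_div_two_mul_I]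
  ext k
  simp only [Finsupp.add_apply, Finsupp.sub_apply, Finsupp.smul_apply, smul_eq_mul,
    Finsupp.single_apply]
  push_cast
  split_ifs <;> ring

theorem ePlus_single_apply_succ (a : ℕ → ℝ) (n : ℕ) :
    ePlus a (Finsupp.single n 1) (n + 1) = Complex.I / 2 * a n := by
  rcases n with _ | n
  · rw [ePlus_single_zero]; simp
  · rw [ePlus_single_succ]
    have h : n ≠ n + 1 + 1 := by omega
    simp [h]

theorem ePlus_single_succ_apply (a : ℕ → ℝ) (n : ℕ) :
    ePlus a (Finsupp.single (n + 1) 1) n = -(Complex.I / 2 * a n) := by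
  rw [ePlus_single_succ]; simp

theorem neg_I_mul_diagOp_zero (a : ℕ → ℝ) :
    -Complex.I * diagOp a (Finsupp.single 0 1) 0 = ((-(1 / 2) + a 0 ^ 2 : ℝ) : ℂ) := by
  have hs (k : ℕ) (z : ℂ) : Finsupp.single k z = z • Finsupp.single k (1 : ℂ) := by simp
  have h1 : jacobiOp a (ePlus a (Finsupp.single 0 1)) 0 = Complex.I / 2 * a 0 * a 0 := by
    rw [ePlus_single_zero, LinearMap.map_add, map_smul, map_smul]
    simp [jacobiOp_single_apply]
  have h2 : ePlus a (jacobiOp a (Finsupp.single 0 1)) 0 = -(Complex.I / 2 * a 0 * a 0) := by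
    rw [jacobiOp_single, if_pos rfl, zero_add, zero_add, hs 1, map_smul, Finsupp.smul_apply,
      ePlus_single_succ_apply, smul_eq_mul]
    ring
  have h3 : ePlus a (Finsupp.single 0 1) 0 = 1 / 4 := by
    rw [ePlus_single_zero]; simp
  simp only [diagOp, LinearMap.sub_apply, LinearMap.smul_apply, Ring.lie_def, Module.End.mul_apply,
    Finsupp.sub_apply, Finsupp.smul_apply, h1, h2, h3, smul_eq_mul]
  push_cast
  linear_combination (1 / 2 - (a 0 : ℂ) ^ 2) * Complex.I_sq

theorem neg_I_mul_diagOp_succ (a : ℕ → ℝ) (n : ℕ) :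
    -Complex.I * diagOp a (Finsupp.single (n + 1) 1) (n + 1) =
      ((-2 * ((n : ℝ) + 1) - 1 / 2 + a (n + 1) ^ 2 - a n ^ 2 : ℝ) : ℂ) := by
  have hs (k : ℕ) (z : ℂ) : Finsupp.single k z = z • Finsupp.single k (1 : ℂ) := by simp
  have h1 : jacobiOp a (ePlus a (Finsupp.single (n + 1) 1)) (n + 1) =
      Complex.I / 2 * (a (n + 1) * a (n + 1) - a n * a n) := by
    rw [ePlus_single_succ, LinearMap.map_add, LinearMap.map_sub, map_smul, map_smul, map_smul]
    have h : n ≠ n + 1 + 1 := by omega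
    simp [jacobiOp_single_apply, h]
    ring
  have h2 : ePlus a (jacobiOp a (Finsupp.single (n + 1) 1)) (n + 1) =
      Complex.I / 2 * (a n * a n - a (n + 1) * a (n + 1)) := by
    rw [jacobiOp_single, if_neg (Nat.succ_ne_zero n), Nat.add_sub_cancel, hs n, hs (n + 1 + 1),
      LinearMap.map_add, map_smul, map_smul, Finsupp.add_apply, Finsupp.smul_apply, Finsupp.smul_apply,
      ePlus_single_succ_apply, ePlus_single_apply_succ, smul_eq_mul, smul_eq_mul]
    ring
  have h3 : ePlus a (Finsupp.single (n + 1) 1) (n + 1) = 1 / 4 + ((n : ℂ) + 1) := by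
    rw [ePlus_single_succ]; simp
  simp only [diagOp, LinearMap.sub_apply, LinearMap.smul_apply, Ring.lie_def, Module.End.mul_apply,
    Finsupp.sub_apply, Finsupp.smul_apply, h1, h2, h3, smul_eq_mul]
  push_cast
  linear_combination (2 * (1 / 4 + ((n : ℂ) + 1)) - ((a (n + 1) : ℂ) ^ 2 - (a n : ℂ) ^ 2)) *
    Complex.I_sq

/-! ### Assembly of the cubic coefficient. -/

/-- The squared Jacobi coefficient `a_{n-1}²`, as a ratio of norms; it vanishes for `n = 0`. -/
noncomputable def normRatio (n : ℕ) (q : ℝ) : ℝ :=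
  if n = 0 then 0 else orthoNorm (moment q) n / orthoNorm (moment q) (n - 1)

theorem normRatio_succ (n : ℕ) (q : ℝ) :
    normRatio (n + 1) q = orthoNorm (moment q) (n + 1) / orthoNorm (moment q) n := by
  simp [normRatio]

theorem analyticAt_normRatio (n : ℕ) : AnalyticAt ℝ (normRatio n) 0 := by
  rcases n with _ | n
  · simpa [normRatio, funext_iff] using! (analyticAt_const (v := (0 : ℝ)) (x := (0 : ℝ)))
  · have h : normRatio (n + 1) = fun q => orthoNorm (moment q) (n + 1) / orthoNorm (moment q) n :=
      funext (normRatio_succ n)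
    rw [h]
    refine (analyticAt_orthoNorm _).div (analyticAt_orthoNorm _) ?_
    rw [orthoNorm_moment_zero]
    exact (baseNorm_pos n).ne'

theorem eventually_neg_I_mul_dEntry (n : ℕ) : ∀ᶠ q in 𝓝 (0 : ℝ), -Complex.I * dEntry n q =
    ((-2 * (n : ℝ) - 1 / 2 + normRatio (n + 1) q - normRatio n q : ℝ) : ℂ) := by
  filter_upwards [eventually_orthoNorm_pos (n + 1)] with q hq
  rw [dEntry, normRatio_succ, ← sq_jacobiCoeff _ n hq]
  rcases n with _ | n
  · rw [neg_I_mul_diagOp_zero]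
    simp [normRatio]
  · rw [neg_I_mul_diagOp_succ, normRatio_succ,
      ← sq_jacobiCoeff _ n fun k hk => hq k (by omega)]
    push_cast; rfl

theorem hasCubicJet_normRatio_succ (n : ℕ) {b c d b' c' d' : ℝ}
    (h : HasCubicJet (fun q => (baseNorm n)⁻¹ * orthoNorm (moment q) n) 1 b c d)
    (h' : HasCubicJet (fun q => (baseNorm (n + 1))⁻¹ * orthoNorm (moment q) (n + 1)) 1 b' c' d') :
    HasCubicJet (normRatio (n + 1)) (((n : ℝ) + 1) * (n + 1 / 2) * (1 * 1))
      (((n : ℝ) + 1) * (n + 1 / 2) * (1 * -b + b' * 1))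
      (((n : ℝ) + 1) * (n + 1 / 2) * (1 * (b ^ 2 - c) + b' * -b + c' * 1))
      (((n : ℝ) + 1) * (n + 1 / 2) *
        (1 * (-b ^ 3 + 2 * b * c - d) + b' * (b ^ 2 - c) + c' * -b + d' * 1)) :=
  ((h'.mul h.inv).const_mul (((n : ℝ) + 1) * (n + 1 / 2))).congr (.of_forall fun q => by
    have h1 := (baseNorm_pos n).ne'
    have h2 : (n : ℝ) + 1 / 2 ≠ 0 := by positivity
    have h3 : (n : ℝ) + 1 ≠ 0 := by positivity
    beta_reduce
    rw [normRatio_succ, baseNorm_succ, mul_inv, mul_inv, mul_inv, inv_inv]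
    field_simp)

theorem HasCubicJet.of_eq {f : ℝ → ℝ} {a b c d d' : ℝ} (h : HasCubicJet f a b c d) (hd : d' = d) :
    HasCubicJet f a b c d' := hd ▸ h

/-- The coefficient of `q³` in the expansion of `-i d_n(q)`. -/
noncomputable def cubicCoeff (n : ℕ) : ℝ :=
  -(1 / 16) * (16 * (n : ℝ) ^ 2 + 8 * n + 3) * tCoeff n ^ 3 * hypergeometricY n ^ 2
    + (1 / 4) * (4 * (n : ℝ) ^ 2 + 11 * n + 3) * tCoeff n ^ 3 * hypergeometricY n
    - (4 * (n : ℝ) ^ 4 + 4 * (n : ℝ) ^ 3 + 23 * (n : ℝ) ^ 2 / 4 + 7 * n / 2 + 3 / 4)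
        * tCoeff n ^ 3
    + (32 * (n : ℝ) ^ 4 + 32 * (n : ℝ) ^ 3 + 48 * (n : ℝ) ^ 2 + 20 * n + 27 / 8)
        * tCoeff n

theorem exists_hasCubicJet (n : ℕ) : ∃ a b c, HasCubicJet
    (fun q => -2 * (n : ℝ) - 1 / 2 + normRatio (n + 1) q - normRatio n q) a b c (cubicCoeff n) := by
  have hone : HasCubicJet (fun _ => -2 * (n : ℝ) - 1 / 2) (-2 * (n : ℝ) - 1 / 2) 0 0 0 :=
    .of_eventuallyEq (.of_forall fun q => by ring)
  have hs0 : paritySum n = (2 - tCoeff n * hypergeometricY n + 2 * n * tCoeff n) / 2 := by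
    linear_combination (1 / 2) * tCoeff_mul_hypergeometricY n - (1 / 2) * paritySum_succ_sub n
  have hs1 : paritySum (n + 1) = (2 - tCoeff n * hypergeometricY n - 2 * n * tCoeff n) / 2 := by
    linear_combination (1 / 2) * tCoeff_mul_hypergeometricY n + (1 / 2) * paritySum_succ_sub n
  have hA := hasCubicJet_normRatio_succ n (hasCubicJet_orthoNorm n) (hasCubicJet_orthoNorm (n + 1))
  rcases n with _ | n
  · have hz : HasCubicJet (normRatio 0) 0 0 0 0 :=
      .of_eventuallyEq (.of_forall fun q => by simp [normRatio])
    have h := (hone.add hA).sub hz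
    refine ⟨_, _, _, h.of_eq ?_⟩
    rw [cubicCoeff, tCoeff_succ, hs1, hs0]
    push_cast
    ring
  · have h := (hone.add hA).sub (hasCubicJet_normRatio_succ n (hasCubicJet_orthoNorm n)
      (hasCubicJet_orthoNorm (n + 1)))
    refine ⟨_, _, _, h.of_eq ?_⟩
    -- The factor `(n+1)(n+2)` clears the denominators of two steps of the recursion, making all
    -- three values of `tCoeff` polynomial multiples of `w`; the identity is then polynomial.
    obtain ⟨w, hw⟩ : ∃ w, tCoeff n = ((n : ℝ) + 1) * (n + 2) * w :=
      ⟨tCoeff n / (((n : ℝ) + 1) * (n + 2)), by field_simp⟩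
    have hw1 : tCoeff (n + 1) = -((n : ℝ) + 1 / 2) * (n + 2) * w := by
      rw [tCoeff_succ, hw]
      field_simp
    have hw2 : tCoeff (n + 2) = ((n : ℝ) + 1 / 2) * (n + 3 / 2) * w := by
      rw [tCoeff_succ, hw1]
      push_cast
      field_simp
      ring
    have hsm : paritySum n = paritySum (n + 2) - tCoeff n := by rw [paritySum_add_two]; ring
    rw [cubicCoeff, hsm, hs1, hs0, hw2, hw1, hw]
    push_cast
    ring

theorem mainTheorem12 (n : ℕ) :
    ∃ (Y : ℝ) (δ : ℕ → ℝ),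
      IsHypergeometricValue 1 ((n : ℝ) + 1 / 2) ((n : ℝ) + 1) (-1) Y ∧
      (∀ᶠ q : ℝ in 𝓝 0,
        HasSum (fun j : ℕ => (δ j : ℂ) * (q : ℂ) ^ j) (-Complex.I * dEntry n q)) ∧
      δ 3 =
        -(1 / 16) * (16 * (n : ℝ) ^ 2 + 8 * n + 3) * tCoeff n ^ 3 * Y ^ 2
          + (1 / 4) * (4 * (n : ℝ) ^ 2 + 11 * n + 3) * tCoeff n ^ 3 * Y
          - (4 * (n : ℝ) ^ 4 + 4 * (n : ℝ) ^ 3 + 23 * (n : ℝ) ^ 2 / 4 + 7 * n / 2 + 3 / 4)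
              * tCoeff n ^ 3
          + (32 * (n : ℝ) ^ 4 + 32 * (n : ℝ) ^ 3 + 48 * (n : ℝ) ^ 2 + 20 * n + 27 / 8)
              * tCoeff n := by
  have ha : AnalyticAt ℝ
      (fun q => -2 * (n : ℝ) - 1 / 2 + normRatio (n + 1) q - normRatio n q) 0 :=
    (analyticAt_const.add (analyticAt_normRatio _)).sub (analyticAt_normRatio _)
  obtain ⟨p, hp⟩ := ha
  obtain ⟨a, b, c, hjet⟩ := exists_hasCubicJet n
  refine ⟨hypergeometricY n, p.coeff, isHypergeometricValue_hypergeometricY n, ?_,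
    hjet.eq_coeff_three hp⟩
  filter_upwards [hp.eventually_hasSum, eventually_neg_I_mul_dEntry n] with q hq hd
  rw [hd]
  have h := Complex.hasSum_ofReal.2 hq
  simp only [zero_add, FormalMultilinearSeries.apply_eq_pow_smul_coeff, smul_eq_mul] at h
  convert! h using 2 with j
  push_cast
  ring
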